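/- Let $q\in L^1_{loc}(\mathbb R)$ be real valued and even, such that $\tau_q(y):=-y''-qy$ is in the limit circle case at $+\infty$ and at $-\infty$ (all solutions $y$ of $\tau_q(y)=\lambda y$, $\lambda\in\mathbb C$, are square integrable near $+\infty$ and near $-\infty$). Let $\mathcal D_{\max}=\{y\in L^2(\mathbb R): y,y'\in AC_{loc}(\mathbb R),\ \tau_q y\in L^2(\mathbb R)\}$, let $A_{\max}y=\tau_q(y)$ for $y\in\mathcal D_{\max}$, and let $A$ be the minimal operator, i.e. the closure in $L^2(\mathbb R)$ of the restriction of $A_{\max}$ to the functions of compact support in $\mathcal D_{\max}$. For $r\in\mathbb N$, an $r$-dimensional extension of $A$ is a closed operator $\widetilde A$ with $A\subset\widetilde A\subset A^*$ and $\dim(\operatorname{dom}\widetilde A/\operatorname{dom}A)=r$. Put $[f,g]_x=\overline{f(x)}g'(x)-\overline{f'(x)}g(x)$ and $[f,g]_{\pm\infty}=\lim_{x\to\pm\infty}[f,g]_x$ (the limits exist for $f,g\in\mathcal D_{\max}$). Let $w_1,w_2\in\mathcal D_{\max}$ be real valued solutions of $\tau_q(y)=0$, $w_1$ odd and $w_2$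 even, with $[w_1,w_2]_{\pm\infty}=1$ and $[w_1,w_1]_{\pm\infty}=[w_2,w_2]_{\pm\infty}=0$. For $f\in\mathcal D_{\max}$ put $\alpha_j(f)=[w_j,f]_{-\infty}$ and $\beta_j(f)=[w_j,f]_{\infty}$, $j=1,2$. Let $(\mathcal Pf)(x)=f(-x)$, and let $T^+:=\mathcal P T^*\mathcal P$ be the adjoint of a densely defined operator $T$ in the Krein space $L^2(\mathbb R)$ with the inner product $[f,g]=\int_{\mathbb R} f\,\overline{\mathcal P g}\,dx$. Let $\widetilde A$ be a $3$-dimensional extension of $A$ with domain $$\operatorname{dom}\widetilde A=\{f\in\mathcal D_{\max}: a\alpha_1(f)+b\alpha_2(f)=c\beta_1(f)+d\beta_2(f)\},$$ where $a,b,c,d\in\mathbb C$, $|a|+|b|+|c|+|d|\neq0$. Then $\widetilde A^*$ and $\widetilde A^+$ are $1$-dimensional extensions of $A$, and: (1) If $a\ne0$, then $\operatorname{dom}\widetilde A^*$ is the set of all $g\in\mathcal D_{\max}$ with $$\overline a\,\alpha_1(g)+\overline b\,\alpha_2(g)=0,\qquad \begin{bmatrix}0&-\overline d/\overline a\\0&\overline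 c/\overline a\end{bmatrix}\begin{pmatrix}\alpha_1(g)\\ \alpha_2(g)\end{pmatrix}=\begin{pmatrix}\beta_1(g)\\ \beta_2(g)\end{pmatrix},$$ and $\operatorname{dom}\widetilde A^+$ is the set of all $h\in\mathcal D_{\max}$ with $$\overline a\,\beta_1(h)-\overline b\,\beta_2(h)=0,\qquad \begin{bmatrix}0&\overline d/\overline a\\0&\overline c/\overline a\end{bmatrix}\begin{pmatrix}\beta_1(h)\\ \beta_2(h)\end{pmatrix}=\begin{pmatrix}\alpha_1(h)\\ \alpha_2(h)\end{pmatrix}.$$ (2) If $b\ne0$, then $\operatorname{dom}\widetilde A^*$ is the set of all $g\in\mathcal D_{\max}$ with $$\overline a\,\alpha_1(g)+\overline b\,\alpha_2(g)=0,\qquad \begin{bmatrix}\overline d/\overline b&0\\-\overline c/\overline b&0\end{bmatrix}\begin{pmatrix}\alpha_1(g)\\ \alpha_2(g)\end{pmatrix}=\begin{pmatrix}\beta_1(g)\\ \beta_2(g)\end{pmatrix},$$ and $\operatorname{dom}\widetilde A^+$ is the set of all $h\in\mathcal D_{\max}$ with $$\overline a\,\beta_1(h)-\overline b\,\beta_2(h)=0,\qquad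 \begin{bmatrix}\overline d/\overline b&0\\ \overline c/\overline b&0\end{bmatrix}\begin{pmatrix}\beta_1(h)\\ \beta_2(h)\end{pmatrix}=\begin{pmatrix}\alpha_1(h)\\ \alpha_2(h)\end{pmatrix}.$$ (3) If $c\ne0$, then $\operatorname{dom}\widetilde A^*$ is the set of all $g\in\mathcal D_{\max}$ with $$\overline c\,\beta_1(g)+\overline d\,\beta_2(g)=0,\qquad \begin{bmatrix}0&-\overline b/\overline c\\0&\overline a/\overline c\end{bmatrix}\begin{pmatrix}\beta_1(g)\\ \beta_2(g)\end{pmatrix}=\begin{pmatrix}\alpha_1(g)\\ \alpha_2(g)\end{pmatrix},$$ and $\operatorname{dom}\widetilde A^+$ is the set of all $h\in\mathcal D_{\max}$ with $$\overline c\,\alpha_1(h)-\overline d\,\alpha_2(h)=0,\qquad \begin{bmatrix}0&\overline b/\overline c\\0&\overline a/\overline c\end{bmatrix}\begin{pmatrix}\alpha_1(h)\\ \alpha_2(h)\end{pmatrix}=\begin{pmatrix}\beta_1(h)\\ \beta_2(h)\end{pmatrix}.$$ (4) If $d\ne0$, then $\operatorname{dom}\widetilde A^*$ is the set of all $g\in\mathcal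 D_{\max}$ with $$\overline c\,\beta_1(g)+\overline d\,\beta_2(g)=0,\qquad \begin{bmatrix}\overline b/\overline d&0\\-\overline a/\overline d&0\end{bmatrix}\begin{pmatrix}\beta_1(g)\\ \beta_2(g)\end{pmatrix}=\begin{pmatrix}\alpha_1(g)\\ \alpha_2(g)\end{pmatrix},$$ and $\operatorname{dom}\widetilde A^+$ is the set of all $h\in\mathcal D_{\max}$ with $$\overline c\,\alpha_1(h)-\overline d\,\alpha_2(h)=0,\qquad \begin{bmatrix}\overline b/\overline d&0\\ \overline a/\overline d&0\end{bmatrix}\begin{pmatrix}\alpha_1(h)\\ \alpha_2(h)\end{pmatrix}=\begin{pmatrix}\beta_1(h)\\ \beta_2(h)\end{pmatrix}.$$ -/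

import Mathlib

open MeasureTheory Filter Topology
open scoped ComplexConjugate LinearPMap

namespace PTExt

noncomputable section

/-- The Hilbert space of (classes of) complex valued square integrable functions on the line. -/
abbrev L2 : Type := Lp ℂ 2 (volume : Measure ℝ)

/-- Absolute continuity on every compact interval. -/
def LocAC (y : ℝ → ℂ) : Prop := ∀ a b : ℝ, AbsolutelyContinuousOnInterval y a b

/-- The differential expression `τ_q y = - y'' - q y`. For `y, y'` locally absolutely continuous
the second derivative exists almost everywhere. -/
def tau (q : ℝ → ℝ) (y : ℝ → ℂ) (x : ℝ) : ℂ := - deriv (deriv y) x - (q x : ℂ) * y x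

/-- `y` is differentiable and `y, y'` are locally absolutely continuous. -/
structure IsRegular (y : ℝ → ℂ) : Prop where
  differentiable : Differentiable ℝ y
  ac : LocAC y
  ac_deriv : LocAC (deriv y)

/-- `y` is a solution of `τ_q y = μ y`. -/
structure IsSolution (q : ℝ → ℝ) (μ : ℂ) (y : ℝ → ℂ) : Prop where
  regular : IsRegular y
  eq : ∀ᵐ x : ℝ, tau q y x = μ * y x

/-- `τ_q` is in the limit circle case at `+∞`. -/
def LimitCircleTop (q : ℝ → ℝ) : Prop :=
  ∀ (μ : ℂ) (y : ℝ → ℂ), IsSolution q μ y →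
    ∃ a : ℝ, MemLp y 2 (volume.restrict (Set.Ioi a))

/-- `τ_q` is in the limit circle case at `-∞`. -/
def LimitCircleBot (q : ℝ → ℝ) : Prop :=
  ∀ (μ : ℂ) (y : ℝ → ℂ), IsSolution q μ y →
    ∃ a : ℝ, MemLp y 2 (volume.restrict (Set.Iio a))

/-- The standing assumptions on the (real valued) potential. -/
structure Admissible (q : ℝ → ℝ) : Prop where
  locInt : LocallyIntegrable q
  even : ∀ x, q (-x) = q x
  top : LimitCircleTop q
  bot : LimitCircleBot q

/-- The functions of the maximal domain: `y ∈ L²`, `y, y' ∈ AC_loc`, `τ_q y ∈ L²`. -/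
structure IsMaxFun (q : ℝ → ℝ) (y : ℝ → ℂ) : Prop where
  regular : IsRegular y
  memLp : MemLp y 2 volume
  memLp_tau : MemLp (tau q y) 2 volume

theorem LocAC.ae_differentiableAt {y : ℝ → ℂ} (h : LocAC y) :
    ∀ᵐ x : ℝ, DifferentiableAt ℝ y x := by
  have h1 : ∀ n : ℕ, ∀ᵐ x : ℝ, x ∈ Set.uIcc (-(n : ℝ)) n → DifferentiableAt ℝ y x := fun n =>
    (h (-(n : ℝ)) n).boundedVariationOn.ae_differentiableAt_of_mem_uIcc
  filter_upwards [ae_all_iff.2 h1] with x hx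
  obtain ⟨n, hn⟩ := exists_nat_ge |x|
  refine hx n ?_
  rw [Set.mem_uIcc]
  exact Or.inl (abs_le.1 hn)

theorem IsRegular.zero : IsRegular (0 : ℝ → ℂ) := by
  have h0 : deriv (0 : ℝ → ℂ) = 0 := by
    funext x; exact deriv_const x (0 : ℂ)
  have h1 : LocAC (0 : ℝ → ℂ) := fun a b => by
    simpa [AbsolutelyContinuousOnInterval] using tendsto_const_nhds
  exact ⟨differentiable_const 0, h1, by rw [h0]; exact h1⟩

theorem IsRegular.add {y z : ℝ → ℂ} (hy : IsRegular y) (hz : IsRegular z) :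
    IsRegular (y + z) := by
  have h : deriv (y + z) = deriv y + deriv z := by
    funext x; exact deriv_add (hy.differentiable x) (hz.differentiable x)
  exact ⟨hy.differentiable.add hz.differentiable, fun a b => (hy.ac a b).add (hz.ac a b),
    by rw [h]; exact fun a b => (hy.ac_deriv a b).add (hz.ac_deriv a b)⟩

theorem IsRegular.smul {y : ℝ → ℂ} (c : ℂ) (hy : IsRegular y) : IsRegular (c • y) := by
  have h : deriv (c • y) = c • deriv y := by
    funext x; exact deriv_const_smul c (hy.differentiable x)
  exact ⟨hy.differentiable.const_smul c, fun a b => (hy.ac a b).const_smul c,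
    by rw [h]; exact fun a b => (hy.ac_deriv a b).const_smul c⟩

theorem tau_zero (q : ℝ → ℝ) : tau q 0 = 0 := by
  have h0 : deriv (0 : ℝ → ℂ) = 0 := by
    funext x; exact deriv_const x (0 : ℂ)
  funext x
  simp [tau, h0]

theorem tau_add (q : ℝ → ℝ) {y z : ℝ → ℂ} (hy : IsRegular y) (hz : IsRegular z) :
    tau q (y + z) =ᵐ[volume] tau q y + tau q z := by
  have h : deriv (y + z) = deriv y + deriv z := by
    funext x; exact deriv_add (hy.differentiable x) (hz.differentiable x)
  filter_upwards [hy.ac_deriv.ae_differentiableAt, hz.ac_deriv.ae_differentiableAt] with x h1 h2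
  have h3 : deriv (deriv y + deriv z) x = deriv (deriv y) x + deriv (deriv z) x :=
    deriv_add h1 h2
  simp only [tau, h, h3, Pi.add_apply]
  ring

theorem tau_smul (q : ℝ → ℝ) (c : ℂ) {y : ℝ → ℂ} (hy : IsRegular y) :
    tau q (c • y) =ᵐ[volume] c • tau q y := by
  have h : deriv (c • y) = c • deriv y := by
    funext x; exact deriv_const_smul c (hy.differentiable x)
  filter_upwards [hy.ac_deriv.ae_differentiableAt] with x h1
  have h3 : deriv (c • deriv y) x = c • deriv (deriv y) x := deriv_const_smul c h1
  simp only [tau, h, h3, Pi.smul_apply, smul_eq_mul]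
  ring

/-- The graph of the maximal operator, a subspace of `L² × L²`. -/
def maxGraph (q : ℝ → ℝ) : Submodule ℂ (L2 × L2) where
  carrier := {p | ∃ y : ℝ → ℂ, IsMaxFun q y ∧ p.1 =ᵐ[volume] y ∧ p.2 =ᵐ[volume] tau q y}
  zero_mem' := by
    refine ⟨0, ⟨IsRegular.zero, MemLp.zero, by rw [tau_zero]; exact MemLp.zero⟩, ?_, ?_⟩
    · exact Lp.coeFn_zero _ _ _
    · rw [tau_zero]; exact Lp.coeFn_zero _ _ _
  add_mem' := by
    rintro p r ⟨y, hy, hy1, hy2⟩ ⟨z, hz, hz1, hz2⟩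
    refine ⟨y + z, ⟨hy.regular.add hz.regular, hy.memLp.add hz.memLp,
      (memLp_congr_ae (tau_add q hy.regular hz.regular)).2 (hy.memLp_tau.add hz.memLp_tau)⟩,
      ?_, ?_⟩
    · exact (Lp.coeFn_add _ _).trans (hy1.add hz1)
    · exact ((Lp.coeFn_add _ _).trans (hy2.add hz2)).trans
        (tau_add q hy.regular hz.regular).symm
  smul_mem' := by
    rintro c p ⟨y, hy, hy1, hy2⟩
    refine ⟨c • y, ⟨hy.regular.smul c, hy.memLp.const_smul c,
      (memLp_congr_ae (tau_smul q c hy.regular)).2 (hy.memLp_tau.const_smul c)⟩, ?_, ?_⟩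
    · exact (Lp.coeFn_smul _ _).trans (hy1.const_smul c)
    · exact ((Lp.coeFn_smul _ _).trans (hy2.const_smul c)).trans (tau_smul q c hy.regular).symm

/-- The maximal operator `A_max`. -/
def maxOp (q : ℝ → ℝ) : L2 →ₗ.[ℂ] L2 := (maxGraph q).toLinearPMap

/-- The graph of `maxOp q` is indeed `maxGraph q`. -/
theorem maxOp_graph (q : ℝ → ℝ) : (maxOp q).graph = maxGraph q := by
  refine Submodule.toLinearPMap_graph_eq _ ?_
  rintro ⟨f, g⟩ ⟨y, hy, hy1, hy2⟩ h0
  simp only at h0 hy1 hy2 ⊢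
  subst h0
  have hy0 : y = 0 := by
    have h1 : y =ᵐ[volume] (0 : ℝ → ℂ) := hy1.symm.trans (Lp.coeFn_zero _ _ _)
    exact (Continuous.ae_eq_iff_eq volume hy.regular.differentiable.continuous
      continuous_const).1 h1
  subst hy0
  rw [tau_zero] at hy2
  exact (Lp.eq_zero_iff_ae_eq_zero).2 hy2

/-- The classes in `L²` having a representative of compact support. -/
def compactlySupported : Submodule ℂ L2 where
  carrier := {f | ∃ y : ℝ → ℂ, HasCompactSupport y ∧ f =ᵐ[volume] y}
  zero_mem' := ⟨0, HasCompactSupport.zero, Lp.coeFn_zero _ _ _⟩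
  add_mem' := by
    rintro f g ⟨y, hy, hfy⟩ ⟨z, hz, hgz⟩
    exact ⟨y + z, hy.add hz, (Lp.coeFn_add _ _).trans (hfy.add hgz)⟩
  smul_mem' := by
    rintro c f ⟨y, hy, hfy⟩
    exact ⟨c • y, hy.smul_left (f := fun _ => c), (Lp.coeFn_smul _ _).trans (hfy.const_smul c)⟩

/-- The pre-minimal operator `A₀`: the maximal operator restricted to the functions of compact
support in its domain. -/
def preMinOp (q : ℝ → ℝ) : L2 →ₗ.[ℂ] L2 := (maxOp q).domRestrict compactlySupported

/-- The minimal operator `A`, the closure of `A₀`. -/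
def minOp (q : ℝ → ℝ) : L2 →ₗ.[ℂ] L2 := (preMinOp q).closure

/-- `T` is an `r`-dimensional bi-extension of `A`: `T` is closed, `A ⊂ T ⊂ A*` and
`dim (dom T / dom A) = r`. -/
structure IsBiExtension (A T : L2 →ₗ.[ℂ] L2) (r : ℕ) : Prop where
  closed : T.IsClosed
  le : A ≤ T
  le_adjoint : T ≤ A†
  rank_eq : Module.rank ℂ (T.domain ⧸ A.domain.submoduleOf T.domain) = r

/-- The parity operator `(P f)(x) = f(-x)` on `L²`. -/
def parity : L2 →ₗᵢ[ℂ] L2 :=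
  Lp.compMeasurePreservingₗᵢ ℂ (fun x : ℝ => -x) (Measure.measurePreserving_neg volume)

/-- `P T P`, with its natural domain `{f | P f ∈ dom T}`. -/
def parityConj (T : L2 →ₗ.[ℂ] L2) : L2 →ₗ.[ℂ] L2 where
  domain := T.domain.comap parity.toLinearMap
  toFun := parity.toLinearMap ∘ₗ T.toFun ∘ₗ
    parity.toLinearMap.restrict (p := T.domain.comap parity.toLinearMap) (q := T.domain)
      (fun _ hx => hx)

/-- The adjoint `T⁺ = P T* P` in the Krein space `L²` with the indefinite inner product
`[f, g] = (f, P g)`, whose fundamental symmetry is `P`. -/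
def kreinAdjoint (T : L2 →ₗ.[ℂ] L2) : L2 →ₗ.[ℂ] L2 := parityConj T†

/-- The expression `[f, g]_x = conj (f x) * g' x - conj (f' x) * g x`. -/
def wr (f g : ℝ → ℂ) (x : ℝ) : ℂ := conj (f x) * deriv g x - conj (deriv f x) * g x

/-- `[w, y]_{-∞}`; see `exists_tendsto_wr_atBot` for the existence of the limit. -/
def bvBot (w y : ℝ → ℂ) : ℂ := limUnder atBot (wr w y)

/-- `[w, y]_{∞}`; see `exists_tendsto_wr_atTop` for the existence of the limit. -/
def bvTop (w y : ℝ → ℂ) : ℂ := limUnder atTop (wr w y)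

/-- A real-valued pair of solutions of `τ_q y = 0` in the maximal domain, `w₁` odd and `w₂` even,
normalized by `[w₁, w₂]_{±∞} = 1`. -/
structure IsBasisPair (q : ℝ → ℝ) (w₁ w₂ : ℝ → ℂ) : Prop where
  max₁ : IsMaxFun q w₁
  max₂ : IsMaxFun q w₂
  sol₁ : IsSolution q 0 w₁
  sol₂ : IsSolution q 0 w₂
  real₁ : ∀ x, conj (w₁ x) = w₁ x
  real₂ : ∀ x, conj (w₂ x) = w₂ x
  odd₁ : ∀ x, w₁ (-x) = - w₁ x
  even₂ : ∀ x, w₂ (-x) = w₂ x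
  wr_bot : Tendsto (wr w₁ w₂) atBot (𝓝 1)
  wr_top : Tendsto (wr w₁ w₂) atTop (𝓝 1)
  wr₁_bot : Tendsto (wr w₁ w₁) atBot (𝓝 0)
  wr₁_top : Tendsto (wr w₁ w₁) atTop (𝓝 0)
  wr₂_bot : Tendsto (wr w₂ w₂) atBot (𝓝 0)
  wr₂_top : Tendsto (wr w₂ w₂) atTop (𝓝 0)

/-- The set of all (classes of) functions `y` in the maximal domain that satisfy `C y`. The
function `y` is unique, being the continuous representative of `f`. -/
def maxDomainWhere (q : ℝ → ℝ) (C : (ℝ → ℂ) → Prop) : Set L2 :=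
  {f | ∃ y : ℝ → ℂ, IsMaxFun q y ∧ f =ᵐ[volume] y ∧ C y}

/-! Existence of the limits of `[f, g]_x` for functions in the maximal domain. -/

theorem LocAC.of_dist_le {X Y : Type*} [PseudoMetricSpace X] [PseudoMetricSpace Y]
    {f : ℝ → X} {g : ℝ → Y} {a b : ℝ} (h : ∀ s t, dist (g s) (g t) ≤ dist (f s) (f t))
    (hf : AbsolutelyContinuousOnInterval f a b) : AbsolutelyContinuousOnInterval g a b :=
  squeeze_zero (fun _ => Finset.sum_nonneg fun _ _ => dist_nonneg)
    (fun _ => Finset.sum_le_sum fun _ _ => h _ _) hf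

theorem LocAC.conj {f : ℝ → ℂ} (hf : LocAC f) : LocAC (fun x => conj (f x)) := fun a b =>
  LocAC.of_dist_le (fun s t => by simp [Complex.dist_conj_conj]) (hf a b)

theorem LocAC.mul {f g : ℝ → ℂ} (hf : LocAC f) (hg : LocAC g) : LocAC (fun x => f x * g x) :=
  fun a b => (hf a b).smul (hg a b)

theorem LocAC.eq_add_integral {f : ℝ → ℂ} (hf : LocAC f) (hi : Integrable (deriv f)) (a b : ℝ) :
    f b = f a + ∫ x in a..b, deriv f x := by
  have key : ∀ (L : ℂ →L[ℝ] ℝ), (∀ z, |L z| ≤ ‖z‖) →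
      L (∫ x in a..b, deriv f x) = L (f b) - L (f a) := by
    intro L hL
    have hac : AbsolutelyContinuousOnInterval (fun x => L (f x)) a b :=
      LocAC.of_dist_le (fun s t => by
        rw [Real.dist_eq, ← map_sub, dist_eq_norm]; exact hL _) (hf a b)
    rw [← hac.integral_deriv_eq_sub, ← L.intervalIntegral_comp_comm hi.intervalIntegrable]
    refine intervalIntegral.integral_congr_ae ?_
    filter_upwards [hf.ae_differentiableAt] with x hx _
    exact ((L.hasFDerivAt.comp_hasDerivAt x hx.hasDerivAt).deriv).symm
  have hre := key Complex.reCLM (fun z => Complex.abs_re_le_norm z)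
  have him := key Complex.imCLM (fun z => Complex.abs_im_le_norm z)
  simp only [Complex.reCLM_apply, Complex.imCLM_apply] at hre him
  apply Complex.ext
  · rw [Complex.add_re, hre]; ring
  · rw [Complex.add_im, him]; ring

theorem wr_locAC {f g : ℝ → ℂ} (hf : IsRegular f) (hg : IsRegular g) : LocAC (wr f g) :=
  fun a b => ((hf.ac.conj.mul hg.ac_deriv) a b).sub ((hf.ac_deriv.conj.mul hg.ac) a b)

theorem integrable_deriv_wr {q : ℝ → ℝ} {f g : ℝ → ℂ} (hf : IsMaxFun q f) (hg : IsMaxFun q g) :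
    Integrable (deriv (wr f g)) := by
  have h1 : Integrable (fun x => conj (tau q f x) * g x) :=
    MemLp.integrable_mul hf.memLp_tau.star hg.memLp
  have h2 : Integrable (fun x => conj (f x) * tau q g x) :=
    MemLp.integrable_mul hf.memLp.star hg.memLp_tau
  refine (h1.sub h2).congr ?_
  filter_upwards [hf.regular.ac_deriv.ae_differentiableAt,
    hg.regular.ac_deriv.ae_differentiableAt] with x hf2 hg2
  have d1 := (hf.regular.differentiable x).hasDerivAt.star.mul hg2.hasDerivAt
  have d2 := hf2.hasDerivAt.star.mul (hg.regular.differentiable x).hasDerivAt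
  have d3 : HasDerivAt (wr f g) _ x := d1.sub d2
  rw [d3.deriv]
  simp only [tau, Pi.sub_apply, map_sub, map_neg, map_mul, Complex.conj_ofReal, Complex.star_def]
  ring

theorem exists_tendsto_wr_atTop {q : ℝ → ℝ} {f g : ℝ → ℂ} (hf : IsMaxFun q f)
    (hg : IsMaxFun q g) : Tendsto (wr f g) atTop (𝓝 (limUnder atTop (wr f g))) := by
  have hi := integrable_deriv_wr hf hg
  have h := (intervalIntegral_tendsto_integral_Ioi 0 hi.integrableOn tendsto_id).const_add
    (wr f g 0)
  refine tendsto_nhds_limUnder ⟨_, h.congr fun x => ?_⟩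
  exact ((wr_locAC hf.regular hg.regular).eq_add_integral hi 0 x).symm

theorem exists_tendsto_wr_atBot {q : ℝ → ℝ} {f g : ℝ → ℂ} (hf : IsMaxFun q f)
    (hg : IsMaxFun q g) : Tendsto (wr f g) atBot (𝓝 (limUnder atBot (wr f g))) := by
  have hi := integrable_deriv_wr hf hg
  have h := (intervalIntegral_tendsto_integral_Iic 0 hi.integrableOn tendsto_id).const_sub
    (wr f g 0)
  refine tendsto_nhds_limUnder ⟨_, h.congr fun x => ?_⟩
  have h2 := (wr_locAC hf.regular hg.regular).eq_add_integral hi x 0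
  rw [h2]
  simp

end

end PTExt

open PTExt

namespace PTExt

open scoped InnerProductSpace

noncomputable section

/-! ### Locally absolutely continuous functions -/

/-! Everything reduces to linear algebra on the boundary values. By Green's formula, `⟪A_max f, g⟫ -
⟪f, A_max g⟫ = [f,g]_∞ - [f,g]_{-∞}` on the maximal domain. The Wronskian of `w₁, w₂` is constantly
1, so a two-by-two determinant identity (`wr_eq`) writes `[f,g]` through the brackets of `f` and `g`
with `w₁, w₂`. Hence the boundary form depends only on the vectors `(α₁, α₂, β₁, β₂)` of `f` and `g`
in `ℂ⁴`, through a nondegenerate sesquilinear form (`form_eq`).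

Three analytic facts make this reduction exact: every vector of `ℂ⁴` is a boundary vector
(`exists_bv`), `A* = A_max` (`adjoint_minOp`), and `dom A` is the set where the boundary vector
vanishes (`mem_minOp_graph`). All of them rest on variation of constants. As `w₁, w₂` are square
integrable, integration from `-∞` solves `τ z = v` inside the maximal domain for every `v` in `L²`,
with boundary values given by the moments of `v` against `w₁, w₂`.

Now `dom T` is the preimage of a hyperplane of `ℂ⁴`, so `dom T*` is the preimage of its complement
under the form, the line spanned by `(-b̄, ā, -d̄, c̄)` (`adjoint_domain`). A one-dimensional space
of boundary vectors gives a one-dimensional extension (`isBiExtension_one`). Reflection exchanges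
the two ends and changes the sign of the brackets with `w₂` (`bv_comp_neg`), so `T⁺` belongs to the
line spanned by `(-d̄, -c̄, -b̄, -ā)`. The cases `a, b, c, d ≠ 0` eliminate the parameter of these
lines through a nonzero coordinate. -/

theorem LocAC.of_re_im {f : ℝ → ℂ}
    (hre : ∀ a b, AbsolutelyContinuousOnInterval (fun x => (f x).re) a b)
    (him : ∀ a b, AbsolutelyContinuousOnInterval (fun x => (f x).im) a b) : LocAC f := by
  intro a b
  have h1 : AbsolutelyContinuousOnInterval (fun x => ((f x).re : ℂ)) a b :=
    LocAC.of_dist_le (fun s t => by simp [Complex.dist_eq, ← Complex.ofReal_sub, Real.dist_eq])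
      (hre a b)
  have h2 : AbsolutelyContinuousOnInterval (fun x => ((f x).im : ℂ)) a b :=
    LocAC.of_dist_le (fun s t => by simp [Complex.dist_eq, ← Complex.ofReal_sub, Real.dist_eq])
      (him a b)
  have h3 := h1.add (h2.const_smul Complex.I)
  have h4 : f = (fun x => ((f x).re : ℂ)) + Complex.I • fun x => ((f x).im : ℂ) := by
    funext x
    simp only [Pi.add_apply, Pi.smul_apply, smul_eq_mul]
    rw [mul_comm, Complex.re_add_im]
  rw [h4]
  exact h3

theorem LocAC.intervalIntegral {g : ℝ → ℂ} (hg : LocallyIntegrable g) (c : ℝ) :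
    LocAC (fun x => ∫ t in c..x, g t) := by
  have hi : ∀ a b, IntervalIntegrable g volume a b := fun a b =>
    (hg.integrableOn_isCompact isCompact_uIcc).intervalIntegrable
  have key : ∀ (L : ℂ →L[ℝ] ℝ) (a b : ℝ),
      AbsolutelyContinuousOnInterval (fun x => L (∫ t in c..x, g t)) a b := by
    intro L a b
    have h0 : ∀ a b, IntervalIntegrable (fun t => L (g t)) volume a b := fun a b =>
      ⟨L.integrable_comp (hi a b).1, L.integrable_comp (hi a b).2⟩
    have h2 : (fun x => L (∫ t in c..x, g t)) = fun x => ∫ t in c..x, L (g t) := by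
      funext x
      exact (L.intervalIntegral_comp_comm (hi c x)).symm
    rw [h2]
    -- The interval is first enlarged to contain the base point `c`, then shrunk back.
    have h3 := (h0 (min (min a b) c)
      (max (max a b) c)).absolutelyContinuousOnInterval_intervalIntegral (c := c) (by rw [Set.mem_uIcc]; left; simp)
    refine h3.mono ?_
    rw [Set.uIcc_of_le (a := min (min a b) c) (by simp)]
    exact Set.Icc_subset_Icc (min_le_left _ _) (le_max_left _ _)
  exact LocAC.of_re_im (key Complex.reCLM) (key Complex.imCLM)

theorem LocAC.sub {f g : ℝ → ℂ} (hf : LocAC f) (hg : LocAC g) : LocAC (fun x => f x - g x) :=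
  fun a b => (hf a b).sub (hg a b)

theorem LocAC.const (z : ℂ) : LocAC fun _ => z := fun a b => by
  simpa [AbsolutelyContinuousOnInterval] using tendsto_const_nhds

theorem LocAC.add {f g : ℝ → ℂ} (hf : LocAC f) (hg : LocAC g) : LocAC (fun x => f x + g x) :=
  fun a b => (hf a b).add (hg a b)

theorem LocAC.eq_of_ae_hasDerivAt_zero {f : ℝ → ℂ} (hf : LocAC f)
    (h : ∀ᵐ x : ℝ, HasDerivAt f 0 x) (a b : ℝ) : f a = f b := by
  obtain ⟨C, hC⟩ := (hf a b).const_of_ae_hasDerivAt_zero (h.mono fun x hx _ => hx)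
  rw [hC a Set.left_mem_uIcc, hC b Set.right_mem_uIcc]

/-- An absolutely continuous function whose derivative agrees almost everywhere with a continuous
function is differentiable everywhere. -/
theorem LocAC.hasDerivAt_of_ae {f G : ℝ → ℂ} (hf : LocAC f) (hG : Continuous G)
    (h : ∀ᵐ x : ℝ, HasDerivAt f (G x) x) (x : ℝ) : HasDerivAt f (G x) x := by
  have hI : ∀ x, HasDerivAt (fun x => ∫ t in (0 : ℝ)..x, G t) (G x) x := fun x =>
    intervalIntegral.integral_hasDerivAt_right (hG.intervalIntegrable _ _)
      (hG.stronglyMeasurableAtFilter _ _) hG.continuousAt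
  -- The difference of `f` and a primitive of `G` is absolutely continuous with derivative zero
  -- almost everywhere, hence constant; so `f` inherits the derivative of the primitive at every
  -- point.
  have h1 : LocAC fun x => f x - ∫ t in (0 : ℝ)..x, G t :=
    hf.sub (LocAC.intervalIntegral hG.locallyIntegrable 0)
  have h2 : f = fun x => f 0 + ∫ t in (0 : ℝ)..x, G t := by
    funext y
    have := h1.eq_of_ae_hasDerivAt_zero
      (h.mono fun x hx => by simpa using! hx.sub (hI x)) y 0
    simp only [intervalIntegral.integral_same, sub_zero] at this
    rw [← this]; ring
  rw [h2]
  exact (hI x).const_add (f 0)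

theorem integral_Iic_eq {g : ℝ → ℂ} (hg : Integrable g) :
    (fun x => ∫ t in Set.Iic x, g t) = fun x => (∫ t in Set.Iic (0 : ℝ), g t)
      + ∫ t in (0 : ℝ)..x, g t := by
  funext x
  rw [← intervalIntegral.integral_Iic_sub_Iic hg.integrableOn hg.integrableOn]
  ring

theorem LocAC.integral_Iic {g : ℝ → ℂ} (hg : Integrable g) :
    LocAC (fun x => ∫ t in Set.Iic x, g t) := by
  rw [integral_Iic_eq hg]
  exact (LocAC.const _).add (LocAC.intervalIntegral hg.locallyIntegrable 0)

theorem ae_hasDerivAt_integral_Iic {g : ℝ → ℂ} (hg : Integrable g) :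
    ∀ᵐ x : ℝ, HasDerivAt (fun x => ∫ t in Set.Iic x, g t) (g x) x := by
  rw [integral_Iic_eq hg]
  filter_upwards [LocallyIntegrable.ae_hasDerivAt_integral hg.locallyIntegrable] with x hx
  exact (hx 0).const_add _

theorem tendsto_integral_Iic_atBot {g : ℝ → ℂ} (hg : Integrable g) :
    Tendsto (fun x => ∫ t in Set.Iic x, g t) atBot (𝓝 0) := by
  rw [integral_Iic_eq hg]
  have h := (intervalIntegral_tendsto_integral_Iic 0 hg.integrableOn tendsto_id).const_sub
    (∫ t in Set.Iic (0 : ℝ), g t)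
  rw [sub_self] at h
  refine h.congr fun x => ?_
  rw [intervalIntegral.integral_symm, id, sub_neg_eq_add]

theorem tendsto_integral_Iic_atTop {g : ℝ → ℂ} (hg : Integrable g) :
    Tendsto (fun x => ∫ t in Set.Iic x, g t) atTop (𝓝 (∫ t, g t)) := by
  rw [integral_Iic_eq hg]
  have h := (intervalIntegral_tendsto_integral_Ioi 0 hg.integrableOn tendsto_id).const_add
    (∫ t in Set.Iic (0 : ℝ), g t)
  rwa [intervalIntegral.integral_Iic_add_Ioi hg.integrableOn hg.integrableOn] at h

theorem norm_integral_Iic_le {g : ℝ → ℂ} (hg : Integrable g) (x : ℝ) :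
    ‖∫ t in Set.Iic x, g t‖ ≤ ∫ t, ‖g t‖ :=
  (norm_integral_le_integral_norm _).trans
    (setIntegral_le_integral hg.norm (ae_of_all _ fun _ => norm_nonneg _))

theorem LocAC.continuous {f : ℝ → ℂ} (hf : LocAC f) : Continuous f := by
  rw [continuous_iff_continuousAt]
  intro x
  refine (hf (x - 1) (x + 1)).continuousOn.continuousAt ?_
  rw [Set.uIcc_of_le (by linarith)]
  exact Icc_mem_nhds (by linarith) (by linarith)

/-! ### The boundary form -/

/-- The products of first derivatives cancel, and so do the potential terms, because `q` is real. -/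
theorem ae_hasDerivAt_wr (q : ℝ → ℝ) {f g : ℝ → ℂ} (hf : IsRegular f) (hg : IsRegular g) :
    ∀ᵐ x : ℝ, HasDerivAt (wr f g) (conj (tau q f x) * g x - conj (f x) * tau q g x) x := by
  filter_upwards [hf.ac_deriv.ae_differentiableAt, hg.ac_deriv.ae_differentiableAt] with x hf2 hg2
  have d1 := (hf.differentiable x).hasDerivAt.star.mul hg2.hasDerivAt
  have d2 := hf2.hasDerivAt.star.mul (hg.differentiable x).hasDerivAt
  have d3 : HasDerivAt (wr f g) _ x := d1.sub d2
  convert! d3 using 1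
  simp only [tau, map_sub, map_neg, map_mul, Complex.conj_ofReal, Complex.star_def]
  ring

/-- Green's formula. -/
theorem integral_green {q : ℝ → ℝ} {f g : ℝ → ℂ} (hf : IsMaxFun q f) (hg : IsMaxFun q g) :
    (∫ x, conj (tau q f x) * g x) - ∫ x, conj (f x) * tau q g x = bvTop f g - bvBot f g := by
  have h1 : Integrable (fun x => conj (tau q f x) * g x) :=
    MemLp.integrable_mul hf.memLp_tau.star hg.memLp
  have h2 : Integrable (fun x => conj (f x) * tau q g x) :=
    MemLp.integrable_mul hf.memLp.star hg.memLp_tau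
  have hi := integrable_deriv_wr hf hg
  rw [← integral_sub h1 h2]
  have h3 : ∫ x, (conj (tau q f x) * g x - conj (f x) * tau q g x) = ∫ x, deriv (wr f g) x :=
    integral_congr_ae ((ae_hasDerivAt_wr q hf.regular hg.regular).mono fun x hx => hx.deriv.symm)
  rw [h3]
  have h4 := (exists_tendsto_wr_atTop hf hg).sub
    ((exists_tendsto_wr_atBot hf hg).comp tendsto_neg_atTop_atBot)
  refine tendsto_nhds_unique (intervalIntegral_tendsto_integral hi
    tendsto_neg_atTop_atBot tendsto_id) (h4.congr fun x => ?_)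
  have := (wr_locAC hf.regular hg.regular).eq_add_integral hi (-x) x
  simp only [Function.comp, id]
  rw [this]; ring

theorem wr_add_right (w : ℝ → ℂ) {f g : ℝ → ℂ} (hf : IsRegular f) (hg : IsRegular g) (x : ℝ) :
    wr w (f + g) x = wr w f x + wr w g x := by
  simp only [wr, deriv_add (hf.differentiable x) (hg.differentiable x), Pi.add_apply]
  ring

theorem wr_smul_right (w : ℝ → ℂ) (c : ℂ) {f : ℝ → ℂ} (hf : IsRegular f) (x : ℝ) :
    wr w (c • f) x = c * wr w f x := by
  simp only [wr, deriv_const_smul c (hf.differentiable x), Pi.smul_apply, smul_eq_mul]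
  ring

theorem IsMaxFun.add {q : ℝ → ℝ} {y z : ℝ → ℂ} (hy : IsMaxFun q y) (hz : IsMaxFun q z) :
    IsMaxFun q (y + z) :=
  ⟨hy.regular.add hz.regular, hy.memLp.add hz.memLp,
    (memLp_congr_ae (tau_add q hy.regular hz.regular)).2 (hy.memLp_tau.add hz.memLp_tau)⟩

theorem IsMaxFun.smul {q : ℝ → ℝ} {y : ℝ → ℂ} (c : ℂ) (hy : IsMaxFun q y) :
    IsMaxFun q (c • y) :=
  ⟨hy.regular.smul c, hy.memLp.const_smul c,
    (memLp_congr_ae (tau_smul q c hy.regular)).2 (hy.memLp_tau.const_smul c)⟩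

theorem bvTop_add {q : ℝ → ℝ} {w f g : ℝ → ℂ} (hw : IsMaxFun q w) (hf : IsMaxFun q f)
    (hg : IsMaxFun q g) : bvTop w (f + g) = bvTop w f + bvTop w g :=
  tendsto_nhds_unique (exists_tendsto_wr_atTop hw (hf.add hg))
    (((exists_tendsto_wr_atTop hw hf).add (exists_tendsto_wr_atTop hw hg)).congr fun x =>
      (wr_add_right w hf.regular hg.regular x).symm)

theorem bvBot_add {q : ℝ → ℝ} {w f g : ℝ → ℂ} (hw : IsMaxFun q w) (hf : IsMaxFun q f)
    (hg : IsMaxFun q g) : bvBot w (f + g) = bvBot w f + bvBot w g :=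
  tendsto_nhds_unique (exists_tendsto_wr_atBot hw (hf.add hg))
    (((exists_tendsto_wr_atBot hw hf).add (exists_tendsto_wr_atBot hw hg)).congr fun x =>
      (wr_add_right w hf.regular hg.regular x).symm)

theorem bvTop_smul {q : ℝ → ℝ} {w f : ℝ → ℂ} (hw : IsMaxFun q w) (c : ℂ) (hf : IsMaxFun q f) :
    bvTop w (c • f) = c * bvTop w f :=
  tendsto_nhds_unique (exists_tendsto_wr_atTop hw (hf.smul c))
    (((exists_tendsto_wr_atTop hw hf).const_mul c).congr fun x =>
      (wr_smul_right w c hf.regular x).symm)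

theorem bvBot_smul {q : ℝ → ℝ} {w f : ℝ → ℂ} (hw : IsMaxFun q w) (c : ℂ) (hf : IsMaxFun q f) :
    bvBot w (c • f) = c * bvBot w f :=
  tendsto_nhds_unique (exists_tendsto_wr_atBot hw (hf.smul c))
    (((exists_tendsto_wr_atBot hw hf).const_mul c).congr fun x =>
      (wr_smul_right w c hf.regular x).symm)

/-! ### Reflection -/

theorem LocAC.comp_neg {f : ℝ → ℂ} (hf : LocAC f) : LocAC (fun x => f (-x)) := by
  intro a b
  rw [absolutelyContinuousOnInterval_iff]
  intro ε hε
  obtain ⟨δ, hδ, h⟩ := (absolutelyContinuousOnInterval_iff _ _ _).1 (hf (-a) (-b)) ε hε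
  refine ⟨δ, hδ, fun E hE hd => ?_⟩
  refine h (E.1, fun i => (-(E.2 i).1, -(E.2 i).2)) ⟨fun i hi => ?_, ?_⟩ ?_
  · have h0 := hE.1 i hi
    simp only [Set.mem_uIcc] at h0 ⊢
    constructor
    · rcases h0.1 with h1 | h1
      · right; constructor <;> linarith [h1.1, h1.2]
      · left; constructor <;> linarith [h1.1, h1.2]
    · rcases h0.2 with h1 | h1
      · right; constructor <;> linarith [h1.1, h1.2]
      · left; constructor <;> linarith [h1.1, h1.2]
  · intro i hi j hj hij
    have h0 := hE.2 hi hj hij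
    -- Reflection moves the closed end of a half-open interval, so the reflected `Set.uIoc` is not
    -- the image of the original one. Disjointness is therefore expressed by an inequality between
    -- endpoints, which is invariant under negation.
    simp only [Function.onFun, Set.uIoc, Set.Ioc_disjoint_Ioc, max_neg_neg, min_neg_neg,
      neg_le_neg_iff] at h0 ⊢
    exact h0
  · simpa using hd

theorem deriv_comp_neg_eq (f : ℝ → ℂ) :
    deriv (fun x => f (-x)) = fun x => - deriv f (-x) :=
  funext fun x => deriv_comp_neg f x

theorem IsMaxFun.comp_neg {q : ℝ → ℝ} (hq : ∀ x, q (-x) = q x) {f : ℝ → ℂ} (hf : IsMaxFun q f) :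
    IsMaxFun q (fun x => f (-x)) ∧ tau q (fun x => f (-x)) = fun x => tau q f (-x) := by
  have ht : tau q (fun x => f (-x)) = fun x => tau q f (-x) := by
    funext x
    have h1 : deriv (fun x => - deriv f (-x)) x = deriv (deriv f) (-x) := by
      rw [deriv.fun_neg, deriv_comp_neg, neg_neg]
    simp only [tau, deriv_comp_neg_eq, h1, hq]
  have hmp := Measure.measurePreserving_neg (volume : Measure ℝ)
  refine ⟨⟨⟨?_, hf.regular.ac.comp_neg, ?_⟩, hf.memLp.comp_measurePreserving hmp, ?_⟩, ht⟩
  · exact hf.regular.differentiable.comp differentiable_neg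
  · rw [deriv_comp_neg_eq]
    exact fun a b => (hf.regular.ac_deriv.comp_neg a b).neg
  · rw [ht]
    exact hf.memLp_tau.comp_measurePreserving hmp

/-! ### Ingredients of variation of constants. -/

theorem conj_deriv_of_real {w : ℝ → ℂ} (h : ∀ x, conj (w x) = w x) (x : ℝ) :
    conj (deriv w x) = deriv w x := by
  have h1 : (fun y => star (w y)) = w := funext h
  have h2 := deriv.star (f := w) (x := x)
  rw [h1] at h2
  exact h2.symm

/-- The solution of `τ_q y = v` obtained by variation of the constants. -/
def varConst (w₁ w₂ v : ℝ → ℂ) (x : ℝ) : ℂ :=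
  w₁ x * (∫ t in Set.Iic x, w₂ t * v t) - w₂ x * ∫ t in Set.Iic x, w₁ t * v t

/-- The derivative of `varConst`. -/
def varConstDeriv (w₁ w₂ v : ℝ → ℂ) (x : ℝ) : ℂ :=
  deriv w₁ x * (∫ t in Set.Iic x, w₂ t * v t) - deriv w₂ x * ∫ t in Set.Iic x, w₁ t * v t

/-- The restriction of `w` to `[-1, 1]`, continued by zero. -/
def cutoff (w : ℝ → ℂ) : ℝ → ℂ := (Set.Icc (-1 : ℝ) 1).indicator w

/-- The squared norm of a real valued function on `[-1, 1]`. -/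
def cutoffNormSq (w : ℝ → ℂ) : ℂ := ∫ t, w t * cutoff w t

theorem memLp_cutoff {w : ℝ → ℂ} (hw : MemLp w 2 volume) : MemLp (cutoff w) 2 volume :=
  hw.indicator measurableSet_Icc

/-- For real valued `w` this is the integral of `|w|²` over `[-1, 1]`. If it vanished, `w` would be
zero near the origin, together with its derivative there. -/
theorem cutoffNormSq_ne_zero {w : ℝ → ℂ} (hw : Differentiable ℝ w) (hr : ∀ x, conj (w x) = w x)
    (h0 : w 0 ≠ 0 ∨ deriv w 0 ≠ 0) : cutoffNormSq w ≠ 0 := by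
  intro h
  have h1 : cutoffNormSq w = ((∫ t in Set.Icc (-1 : ℝ) 1, ‖w t‖ ^ 2 : ℝ) : ℂ) := by
    have : (fun t => w t * cutoff w t) =
        (Set.Icc (-1 : ℝ) 1).indicator fun t => ((‖w t‖ ^ 2 : ℝ) : ℂ) := by
      funext t
      by_cases ht : t ∈ Set.Icc (-1 : ℝ) 1
      · simp only [cutoff, Set.indicator_of_mem ht]
        nth_rw 2 [← hr t]
        rw [Complex.mul_conj, Complex.normSq_eq_norm_sq]
      · simp [cutoff, Set.indicator_of_notMem ht]
    rw [cutoffNormSq, this, integral_indicator measurableSet_Icc, integral_complex_ofReal]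
  rw [h1, Complex.ofReal_eq_zero] at h
  have hc : Continuous fun t => ‖w t‖ ^ 2 := hw.continuous.norm.pow 2
  rw [setIntegral_eq_zero_iff_of_nonneg_ae (ae_of_all _ fun _ => by positivity)
    hc.continuousOn.integrableOn_Icc] at h
  have h2 : Set.EqOn (fun t => ‖w t‖ ^ 2) (fun _ => 0) (Set.Ioo (-1 : ℝ) 1) := by
    refine Measure.eqOn_open_of_ae_eq
      (ae_restrict_of_ae_restrict_of_subset Set.Ioo_subset_Icc_self h) isOpen_Ioo
      hc.continuousOn continuousOn_const
  have h3 : w =ᶠ[𝓝 0] fun _ => 0 := by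
    filter_upwards [Ioo_mem_nhds (show (-1 : ℝ) < 0 by norm_num) one_pos] with t ht
    simpa using h2 ht
  rcases h0 with h0 | h0
  · exact h0 h3.eq_of_nhds
  · exact h0 (by rw [h3.deriv_eq]; simp)

/-- To the left of the support of `v` both partial integrals are zero; to the right they equal the
full moments, which vanish by assumption. -/
theorem hasCompactSupport_varConst {w₁ w₂ v : ℝ → ℂ} (hs : HasCompactSupport v)
    (h₁ : ∫ t, w₁ t * v t = 0) (h₂ : ∫ t, w₂ t * v t = 0) :
    HasCompactSupport (varConst w₁ w₂ v) := by
  obtain ⟨R, hR⟩ := hs.isCompact.isBounded.subset_closedBall 0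
  have hv0 : ∀ t, t ∉ Set.Icc (-R) R → v t = 0 := fun t ht => by
    by_contra h
    have := hR (subset_tsupport v h)
    rw [Real.closedBall_eq_Icc] at this
    simp only [zero_sub, zero_add] at this
    exact ht this
  have key : ∀ w : ℝ → ℂ, ∫ t, w t * v t = 0 → ∀ x, x ∉ Set.Icc (-R) R →
      ∫ t in Set.Iic x, w t * v t = 0 := by
    intro w hw0 x hx
    rcases lt_or_ge x (-R) with h | h
    · refine setIntegral_eq_zero_of_forall_eq_zero fun t ht => ?_
      rw [hv0 t fun h' => absurd (h'.1.trans ht) (not_le.2 h), mul_zero]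
    · have hx2 : R < x := by
        by_contra h'
        exact hx ⟨h, not_lt.1 h'⟩
      rw [setIntegral_eq_integral_of_forall_compl_eq_zero, hw0]
      intro t ht
      rw [hv0 t fun h' => ht (h'.2.trans hx2.le), mul_zero]
  refine HasCompactSupport.intro (isCompact_Icc (a := -R) (b := R)) fun x hx => ?_
  rw [varConst, key _ h₁ x hx, key _ h₂ x hx]
  simp

/-! ### Consequences of the normalized basis: Wronskian, variation of constants, boundary values. -/

namespace IsBasisPair

variable {q : ℝ → ℝ} {w₁ w₂ : ℝ → ℂ} (hw : IsBasisPair q w₁ w₂)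
include hw

/-- Both functions solve `τ y = 0`, so the Wronskian is constant; its limit at `+∞` fixes the value.
-/
theorem wr_eq_one (x : ℝ) : wr w₁ w₂ x = 1 := by
  have h : ∀ y, wr w₁ w₂ y = wr w₁ w₂ x := fun y =>
    (wr_locAC hw.max₁.regular hw.max₂.regular).eq_of_ae_hasDerivAt_zero (by
      filter_upwards [ae_hasDerivAt_wr q hw.max₁.regular hw.max₂.regular, hw.sol₁.eq, hw.sol₂.eq]
        with y h1 h2 h3
      rw [h2, h3] at h1
      simpa using h1) y x
  exact tendsto_nhds_unique (tendsto_const_nhds.congr fun y => (h y).symm) hw.wr_top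

theorem wronskian (x : ℝ) : w₁ x * deriv w₂ x - deriv w₁ x * w₂ x = 1 := by
  have h := hw.wr_eq_one x
  rwa [wr, conj_deriv_of_real hw.real₁, hw.real₁] at h

theorem wr₁ (f : ℝ → ℂ) (x : ℝ) : wr w₁ f x = w₁ x * deriv f x - deriv w₁ x * f x := by
  rw [wr, conj_deriv_of_real hw.real₁, hw.real₁]

theorem wr₂ (f : ℝ → ℂ) (x : ℝ) : wr w₂ f x = w₂ x * deriv f x - deriv w₂ x * f x := by
  rw [wr, conj_deriv_of_real hw.real₂, hw.real₂]

/-- The Plücker relation for two-by-two determinants: the right side equals `[f, g]` times the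
Wronskian of `w₁, w₂`, which is 1. -/
theorem wr_eq (f g : ℝ → ℂ) (x : ℝ) :
    wr f g x = conj (wr w₁ f x) * wr w₂ g x - conj (wr w₂ f x) * wr w₁ g x := by
  have h := hw.wronskian x
  rw [hw.wr₁, hw.wr₁, hw.wr₂, hw.wr₂]
  simp only [map_sub, map_mul, hw.real₁, hw.real₂, conj_deriv_of_real hw.real₁,
    conj_deriv_of_real hw.real₂, wr]
  linear_combination (-(conj (f x) * deriv g x - conj (deriv f x) * g x)) * h

theorem bvTop_eq {f g : ℝ → ℂ} (hf : IsMaxFun q f) (hg : IsMaxFun q g) :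
    bvTop f g = conj (bvTop w₁ f) * bvTop w₂ g - conj (bvTop w₂ f) * bvTop w₁ g := by
  have h (w) (hm : IsMaxFun q w) (y) (hy : IsMaxFun q y) := exists_tendsto_wr_atTop hm hy
  refine tendsto_nhds_unique (h f hf g hg) ?_
  rw [funext (hw.wr_eq f g)]
  exact (((Complex.continuous_conj.tendsto _).comp (h _ hw.max₁ _ hf)).mul (h _ hw.max₂ _ hg)).sub
    (((Complex.continuous_conj.tendsto _).comp (h _ hw.max₂ _ hf)).mul (h _ hw.max₁ _ hg))

theorem bvBot_eq {f g : ℝ → ℂ} (hf : IsMaxFun q f) (hg : IsMaxFun q g) :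
    bvBot f g = conj (bvBot w₁ f) * bvBot w₂ g - conj (bvBot w₂ f) * bvBot w₁ g := by
  have h (w) (hm : IsMaxFun q w) (y) (hy : IsMaxFun q y) := exists_tendsto_wr_atBot hm hy
  refine tendsto_nhds_unique (h f hf g hg) ?_
  rw [funext (hw.wr_eq f g)]
  exact (((Complex.continuous_conj.tendsto _).comp (h _ hw.max₁ _ hf)).mul (h _ hw.max₂ _ hg)).sub
    (((Complex.continuous_conj.tendsto _).comp (h _ hw.max₂ _ hf)).mul (h _ hw.max₁ _ hg))

theorem integrable_mul₁ {v : ℝ → ℂ} (hv : MemLp v 2 volume) :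
    Integrable fun t => w₁ t * v t := hw.max₁.memLp.integrable_mul hv

theorem integrable_mul₂ {v : ℝ → ℂ} (hv : MemLp v 2 volume) :
    Integrable fun t => w₂ t * v t := hw.max₂.memLp.integrable_mul hv

/-- The partial integrals are differentiable only almost everywhere, but the terms `w₁ w₂ v` of the
product rule cancel. What remains is continuous, and absolute continuity extends the formula to
every point. -/
theorem hasDerivAt_varConst {v : ℝ → ℂ} (hv : MemLp v 2 volume) (x : ℝ) :
    HasDerivAt (varConst w₁ w₂ v) (varConstDeriv w₁ w₂ v x) x := by
  have h1 := hw.integrable_mul₁ hv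
  have h2 := hw.integrable_mul₂ hv
  have r1 := hw.max₁.regular
  have r2 := hw.max₂.regular
  refine LocAC.hasDerivAt_of_ae (G := varConstDeriv w₁ w₂ v) ((r1.ac.mul (LocAC.integral_Iic h2)).sub
    (r2.ac.mul (LocAC.integral_Iic h1)))
    ((r1.ac_deriv.continuous.mul (LocAC.integral_Iic h2).continuous).sub
      (r2.ac_deriv.continuous.mul (LocAC.integral_Iic h1).continuous)) ?_ x
  filter_upwards [ae_hasDerivAt_integral_Iic h1, ae_hasDerivAt_integral_Iic h2] with y k1 k2
  have h : HasDerivAt (varConst w₁ w₂ v) _ y := ((r1.differentiable y).hasDerivAt.mul k2).sub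
    ((r2.differentiable y).hasDerivAt.mul k1)
  refine h.congr_deriv ?_
  rw [varConstDeriv]
  ring

theorem isRegular_varConst {v : ℝ → ℂ} (hv : MemLp v 2 volume) :
    IsRegular (varConst w₁ w₂ v) := by
  have h1 := hw.integrable_mul₁ hv
  have h2 := hw.integrable_mul₂ hv
  have r1 := hw.max₁.regular
  have r2 := hw.max₂.regular
  refine ⟨fun x => (hw.hasDerivAt_varConst hv x).differentiableAt,
    (r1.ac.mul (LocAC.integral_Iic h2)).sub (r2.ac.mul (LocAC.integral_Iic h1)), ?_⟩
  rw [funext fun x => (hw.hasDerivAt_varConst hv x).deriv]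
  exact (r1.ac_deriv.mul (LocAC.integral_Iic h2)).sub (r2.ac_deriv.mul (LocAC.integral_Iic h1))

/-- The second differentiation leaves, besides the terms killed by the equations for `w₁, w₂`, the
function `v` multiplied by the Wronskian. -/
theorem tau_varConst {v : ℝ → ℂ} (hv : MemLp v 2 volume) :
    tau q (varConst w₁ w₂ v) =ᵐ[volume] v := by
  have h1 := hw.integrable_mul₁ hv
  have h2 := hw.integrable_mul₂ hv
  filter_upwards [ae_hasDerivAt_integral_Iic h1, ae_hasDerivAt_integral_Iic h2,
    hw.max₁.regular.ac_deriv.ae_differentiableAt, hw.max₂.regular.ac_deriv.ae_differentiableAt,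
    hw.sol₁.eq, hw.sol₂.eq] with x k1 k2 d1 d2 e1 e2
  have h3 : HasDerivAt (varConstDeriv w₁ w₂ v) _ x :=
    (d1.hasDerivAt.mul k2).sub (d2.hasDerivAt.mul k1)
  have h4 := h3.deriv
  rw [← funext fun x => (hw.hasDerivAt_varConst hv x).deriv] at h4
  simp only [tau, zero_mul] at e1 e2
  simp only [tau]
  rw [h4, varConst]
  linear_combination (∫ t in Set.Iic x, w₂ t * v t) * e1 - (∫ t in Set.Iic x, w₁ t * v t) * e2
    + v x * hw.wronskian x

/-- The partial integrals are bounded by `L¹` norms of `w₁ v` and `w₂ v`, so the function is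
dominated by multiples of the square integrable `w₁, w₂`. -/
theorem isMaxFun_varConst {v : ℝ → ℂ} (hv : MemLp v 2 volume) :
    IsMaxFun q (varConst w₁ w₂ v) := by
  have h1 := hw.integrable_mul₁ hv
  have h2 := hw.integrable_mul₂ hv
  refine ⟨hw.isRegular_varConst hv, ?_, (memLp_congr_ae (hw.tau_varConst hv)).2 hv⟩
  have key : ∀ {w g : ℝ → ℂ}, IsMaxFun q w → Integrable g →
      MemLp (fun x => w x * ∫ t in Set.Iic x, g t) 2 volume := by
    intro w g hm hg
    refine hm.memLp.of_le_mul (c := ∫ t, ‖g t‖)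
      (hm.regular.ac.continuous.mul (LocAC.integral_Iic hg).continuous).aestronglyMeasurable
      (ae_of_all _ fun x => ?_)
    rw [norm_mul, mul_comm]
    exact mul_le_mul_of_nonneg_right (norm_integral_Iic_le hg x) (norm_nonneg _)
  exact (key hw.max₁ h2).sub (key hw.max₂ h1)

theorem wr₁_varConst {v : ℝ → ℂ} (hv : MemLp v 2 volume) :
    wr w₁ (varConst w₁ w₂ v) = fun x => - ∫ t in Set.Iic x, w₁ t * v t := by
  funext x
  rw [hw.wr₁, (hw.hasDerivAt_varConst hv x).deriv, varConst, varConstDeriv]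
  linear_combination (- ∫ t in Set.Iic x, w₁ t * v t) * hw.wronskian x

theorem wr₂_varConst {v : ℝ → ℂ} (hv : MemLp v 2 volume) :
    wr w₂ (varConst w₁ w₂ v) = fun x => - ∫ t in Set.Iic x, w₂ t * v t := by
  funext x
  rw [hw.wr₂, (hw.hasDerivAt_varConst hv x).deriv, varConst, varConstDeriv]
  linear_combination (- ∫ t in Set.Iic x, w₂ t * v t) * hw.wronskian x

/-- Starting the integrals at `-∞` kills the boundary values there, while those at `+∞` become
adjustable through the moments of `v`. -/
theorem bv_varConst {v : ℝ → ℂ} (hv : MemLp v 2 volume) :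
    bvBot w₁ (varConst w₁ w₂ v) = 0 ∧ bvBot w₂ (varConst w₁ w₂ v) = 0 ∧
    bvTop w₁ (varConst w₁ w₂ v) = - ∫ t, w₁ t * v t ∧
    bvTop w₂ (varConst w₁ w₂ v) = - ∫ t, w₂ t * v t := by
  have h1 := hw.integrable_mul₁ hv
  have h2 := hw.integrable_mul₂ hv
  simp only [bvBot, bvTop, hw.wr₁_varConst hv, hw.wr₂_varConst hv]
  refine ⟨?_, ?_, (tendsto_integral_Iic_atTop h1).neg.limUnder_eq,
    (tendsto_integral_Iic_atTop h2).neg.limUnder_eq⟩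
  · simpa using (tendsto_integral_Iic_atBot h1).neg.limUnder_eq
  · simpa using (tendsto_integral_Iic_atBot h2).neg.limUnder_eq

/-- The cutoff interval is symmetric, so both integrands are odd. -/
theorem integral_cutoff_cross : ∫ t, w₁ t * cutoff w₂ t = 0 ∧ ∫ t, w₂ t * cutoff w₁ t = 0 := by
  have hI : ∀ t : ℝ, -t ∈ Set.Icc (-1 : ℝ) 1 ↔ t ∈ Set.Icc (-1 : ℝ) 1 := fun t => by
    simp only [Set.mem_Icc]
    constructor <;> intro h <;> constructor <;> linarith [h.1, h.2]
  have key : ∀ g : ℝ → ℂ, (∀ t, g (-t) = - g t) → ∫ t, g t = 0 := fun g hg => by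
    have h := integral_neg_eq_self g volume
    simp only [hg, integral_neg] at h
    exact self_eq_neg.1 h.symm
  constructor <;> refine key _ fun t => ?_ <;> by_cases ht : t ∈ Set.Icc (-1 : ℝ) 1
  all_goals
    have ht' := ht
    rw [← hI] at ht'
    simp [cutoff, ht, ht', hw.odd₁, hw.even₂]

theorem cutoffNormSq₁ : cutoffNormSq w₁ ≠ 0 := by
  refine cutoffNormSq_ne_zero hw.max₁.regular.differentiable hw.real₁ ?_
  by_contra! h
  simpa [h.1, h.2] using hw.wronskian 0

theorem cutoffNormSq₂ : cutoffNormSq w₂ ≠ 0 := by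
  refine cutoffNormSq_ne_zero hw.max₂.regular.differentiable hw.real₂ ?_
  by_contra! h
  simpa [h.1, h.2] using hw.wronskian 0

/-- There are functions of compact support with arbitrary moments against `w₁` and `w₂`. -/
theorem exists_moments (z₁ z₂ : ℂ) : ∃ v : ℝ → ℂ, MemLp v 2 volume ∧ HasCompactSupport v ∧
    ∫ t, w₁ t * v t = z₁ ∧ ∫ t, w₂ t * v t = z₂ := by
  have m1 := memLp_cutoff hw.max₁.memLp
  have m2 := memLp_cutoff hw.max₂.memLp
  have hs : ∀ w : ℝ → ℂ, HasCompactSupport (cutoff w) := fun w =>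
    HasCompactSupport.intro isCompact_Icc fun x hx => Set.indicator_of_notMem hx w
  -- The mixed moments of the cutoffs vanish, so the two coefficients can be chosen independently.
  refine ⟨fun t => z₁ / cutoffNormSq w₁ * cutoff w₁ t + z₂ / cutoffNormSq w₂ * cutoff w₂ t,
    (m1.const_mul _).add (m2.const_mul _), (hs w₁).mul_left.add (hs w₂).mul_left, ?_, ?_⟩
  · have : (fun t => w₁ t * (z₁ / cutoffNormSq w₁ * cutoff w₁ t + z₂ / cutoffNormSq w₂ * cutoff w₂ t))
      = fun t => z₁ / cutoffNormSq w₁ * (w₁ t * cutoff w₁ t)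
        + z₂ / cutoffNormSq w₂ * (w₁ t * cutoff w₂ t) := by funext t; ring
    rw [this, integral_add ((hw.integrable_mul₁ m1).const_mul _)
      ((hw.integrable_mul₁ m2).const_mul _), integral_const_mul, integral_const_mul,
      hw.integral_cutoff_cross.1, mul_zero, add_zero]
    exact div_mul_cancel₀ _ hw.cutoffNormSq₁
  · have : (fun t => w₂ t * (z₁ / cutoffNormSq w₁ * cutoff w₁ t + z₂ / cutoffNormSq w₂ * cutoff w₂ t))
      = fun t => z₁ / cutoffNormSq w₁ * (w₂ t * cutoff w₁ t)
        + z₂ / cutoffNormSq w₂ * (w₂ t * cutoff w₂ t) := by funext t; ring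
    rw [this, integral_add ((hw.integrable_mul₂ m1).const_mul _)
      ((hw.integrable_mul₂ m2).const_mul _), integral_const_mul, integral_const_mul,
      hw.integral_cutoff_cross.2, mul_zero, zero_add]
    exact div_mul_cancel₀ _ hw.cutoffNormSq₂

theorem bv_self : bvBot w₁ w₁ = 0 ∧ bvBot w₂ w₂ = 0 ∧ bvBot w₁ w₂ = 1 ∧ bvBot w₂ w₁ = -1 ∧
    bvTop w₁ w₁ = 0 ∧ bvTop w₂ w₂ = 0 ∧ bvTop w₁ w₂ = 1 ∧ bvTop w₂ w₁ = -1 := by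
  have h : wr w₂ w₁ = fun _ => -1 := funext fun x => by
    rw [hw.wr₂]; linear_combination -hw.wronskian x
  have hb : Tendsto (wr w₂ w₁) atBot (𝓝 (-1)) := by rw [h]; exact tendsto_const_nhds
  have ht : Tendsto (wr w₂ w₁) atTop (𝓝 (-1)) := by rw [h]; exact tendsto_const_nhds
  exact ⟨hw.wr₁_bot.limUnder_eq, hw.wr₂_bot.limUnder_eq, hw.wr_bot.limUnder_eq, hb.limUnder_eq,
    hw.wr₁_top.limUnder_eq, hw.wr₂_top.limUnder_eq, hw.wr_top.limUnder_eq, ht.limUnder_eq⟩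

/-- The boundary values of a function in the maximal domain can be prescribed. -/
theorem exists_bv (x₁ x₂ y₁ y₂ : ℂ) : ∃ f, IsMaxFun q f ∧ bvBot w₁ f = x₁ ∧ bvBot w₂ f = x₂ ∧
    bvTop w₁ f = y₁ ∧ bvTop w₂ f = y₂ := by
  -- The combination `-x₂ w₁ + x₁ w₂` has boundary values `x₁, x₂` at both ends. Variation of
  -- constants leaves `-∞` untouched and subtracts the moments of `v` at `+∞`, so these must be `x₁
  -- - y₁` and `x₂ - y₂`.
  obtain ⟨v, hv, -, h1, h2⟩ := hw.exists_moments (x₁ - y₁) (x₂ - y₂)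
  obtain ⟨b1, b2, b3, b4⟩ := hw.bv_varConst hv
  obtain ⟨s1, s2, s3, s4, s5, s6, s7, s8⟩ := hw.bv_self
  have mz := hw.isMaxFun_varConst hv
  have m1 := hw.max₁
  have m2 := hw.max₂
  have m1' := m1.smul (-x₂)
  have m2' := m2.smul x₁
  refine ⟨varConst w₁ w₂ v + ((-x₂) • w₁ + x₁ • w₂), mz.add (m1'.add m2'), ?_, ?_, ?_, ?_⟩
  · rw [bvBot_add m1 mz (m1'.add m2'), bvBot_add m1 m1' m2', bvBot_smul m1 _ m1,
      bvBot_smul m1 _ m2, b1, s1, s3]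
    ring
  · rw [bvBot_add m2 mz (m1'.add m2'), bvBot_add m2 m1' m2', bvBot_smul m2 _ m1,
      bvBot_smul m2 _ m2, b2, s2, s4]
    ring
  · rw [bvTop_add m1 mz (m1'.add m2'), bvTop_add m1 m1' m2', bvTop_smul m1 _ m1,
      bvTop_smul m1 _ m2, b3, s5, s7, h1]
    ring
  · rw [bvTop_add m2 mz (m1'.add m2'), bvTop_add m2 m1' m2', bvTop_smul m2 _ m1,
      bvTop_smul m2 _ m2, b4, s6, s8, h2]
    ring

/-- Reflection reverses the sign of the derivative of `f`. With the odd `w₁` this sign is absorbed,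
with the even `w₂` it survives. -/
theorem bv_comp_neg {f : ℝ → ℂ} (hf : IsMaxFun q f) :
    bvBot w₁ (fun x => f (-x)) = bvTop w₁ f ∧ bvBot w₂ (fun x => f (-x)) = - bvTop w₂ f ∧
    bvTop w₁ (fun x => f (-x)) = bvBot w₁ f ∧ bvTop w₂ (fun x => f (-x)) = - bvBot w₂ f := by
  have d1 : ∀ x, deriv w₁ (-x) = deriv w₁ x := fun x => by
    have h := congrFun (deriv_comp_neg_eq w₁) x
    rw [funext hw.odd₁, deriv.fun_neg] at h
    exact (neg_injective h).symm
  have d2 : ∀ x, deriv w₂ (-x) = - deriv w₂ x := fun x => by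
    have h := congrFun (deriv_comp_neg_eq w₂) x
    rw [funext hw.even₂] at h
    rw [h, neg_neg]
  have h1 : wr w₁ (fun x => f (-x)) = fun x => wr w₁ f (-x) := by
    funext x
    rw [hw.wr₁, hw.wr₁, deriv_comp_neg_eq, d1, hw.odd₁]; ring
  have h2 : wr w₂ (fun x => f (-x)) = fun x => - wr w₂ f (-x) := by
    funext x
    rw [hw.wr₂, hw.wr₂, deriv_comp_neg_eq, d2, hw.even₂]; ring
  simp only [bvBot, bvTop, h1, h2]
  exact ⟨((exists_tendsto_wr_atTop hw.max₁ hf).comp tendsto_neg_atBot_atTop).limUnder_eq,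
    ((exists_tendsto_wr_atTop hw.max₂ hf).comp tendsto_neg_atBot_atTop).neg.limUnder_eq,
    ((exists_tendsto_wr_atBot hw.max₁ hf).comp tendsto_neg_atTop_atBot).limUnder_eq,
    ((exists_tendsto_wr_atBot hw.max₂ hf).comp tendsto_neg_atTop_atBot).neg.limUnder_eq⟩

end IsBasisPair

/-! ### Graphs and adjoints -/

section Graph

variable {E : Type*} [NormedAddCommGroup E] [InnerProductSpace ℂ E]

/-- In the Hilbert space product, the adjoint of a graph is its orthogonal complement up to the
rotation `(x, y) ↦ (y, -x)`. The double adjoint is thus the double orthogonal complement, which is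
the closure. -/
theorem mem_topologicalClosure_of_adjoint [CompleteSpace E] {g : Submodule ℂ (E × E)} {p : E × E}
    (h : ∀ x ∈ g.adjoint, ⟪p.2, x.1⟫_ℂ - ⟪p.1, x.2⟫_ℂ = 0) : p ∈ g.topologicalClosure := by
  let e := WithLp.prodContinuousLinearEquiv 2 ℂ E E
  let K : Submodule ℂ (WithLp 2 (E × E)) := g.map (e.symm : E × E →ₗ[ℂ] WithLp 2 (E × E))
  have hp : e.symm p ∈ K.topologicalClosure := by
    rw [← Submodule.orthogonal_orthogonal_eq_closure, Submodule.mem_orthogonal']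
    intro x hx
    rw [Submodule.mem_orthogonal] at hx
    have hx' : (x.snd, -x.fst) ∈ g.adjoint := by
      rw [Submodule.mem_adjoint_iff]
      intro a b hab
      have := hx (e.symm (a, b)) ⟨(a, b), hab, rfl⟩
      rw [WithLp.prod_inner_apply] at this
      simp only [inner_neg_right, sub_neg_eq_add]
      rw [add_comm]
      exact this
    have := h _ hx'
    simp only [inner_neg_right, sub_neg_eq_add] at this
    rw [WithLp.prod_inner_apply, add_comm]
    exact this
  have h1 : e '' closure (K : Set (WithLp 2 (E × E))) = closure (e '' K) :=
    e.image_closure _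
  have h2 : e '' (K : Set (WithLp 2 (E × E))) = g := by
    simp [K, Set.image_image]
  rw [h2] at h1
  rw [← SetLike.mem_coe, Submodule.topologicalClosure_coe, ← h1]
  exact ⟨e.symm p, hp, e.apply_symm_apply p⟩

theorem adjoint_topologicalClosure (g : Submodule ℂ (E × E)) :
    g.topologicalClosure.adjoint = g.adjoint := by
  ext x
  simp only [Submodule.mem_adjoint_iff]
  refine ⟨fun h a b hab => h a b (g.le_topologicalClosure hab), fun h a b hab => ?_⟩
  have hc : IsClosed {p : E × E | ⟪p.2, x.1⟫_ℂ - ⟪p.1, x.2⟫_ℂ = 0} :=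
    isClosed_eq (by fun_prop) continuous_const
  exact closure_minimal (s := (g : Set (E × E))) (fun p hp => h p.1 p.2 hp) hc hab

end Graph

/-! ### From `L²` classes to representatives, and functions of compact support. -/

theorem inner_eq_integral {f g : L2} {y z : ℝ → ℂ} (hf : f =ᵐ[volume] y) (hg : g =ᵐ[volume] z) :
    ⟪f, g⟫_ℂ = ∫ x, conj (y x) * z x := by
  rw [L2.inner_def]
  refine integral_congr_ae ?_
  filter_upwards [hf, hg] with x h1 h2
  rw [h1, h2, RCLike.inner_apply, mul_comm]

theorem integral_sub_add {f g h : ℝ → ℂ} (hf : Integrable f) (hg : Integrable g)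
    (hh : Integrable h) (c d : ℂ) : ∫ t, (f t - (c * g t + d * h t)) =
      (∫ t, f t) - (c * (∫ t, g t) + d * ∫ t, h t) := by
  have h1 : Integrable fun t => c * g t := hg.const_mul c
  have h2 : Integrable fun t => d * h t := hh.const_mul d
  have h3 : Integrable fun t => c * g t + d * h t := h1.add h2
  rw [integral_sub hf h3, integral_add h1 h2, integral_const_mul, integral_const_mul]

theorem mem_preMinOp_graph {q : ℝ → ℝ} {p : L2 × L2} :
    p ∈ (preMinOp q).graph ↔ p ∈ maxGraph q ∧ p.1 ∈ compactlySupported := by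
  rw [← maxOp_graph, LinearPMap.mem_graph_iff, LinearPMap.mem_graph_iff]
  constructor
  · rintro ⟨⟨y, hy1, hy2⟩, h1, h2⟩
    refine ⟨⟨⟨y, hy2⟩, h1, ?_⟩, h1 ▸ hy1⟩
    rw [← h2]
    exact (LinearPMap.domRestrict_apply rfl).symm
  · rintro ⟨⟨⟨y, hy2⟩, h1, h2⟩, h3⟩
    rw [← h1] at h3
    refine ⟨⟨y, h3, hy2⟩, h1, ?_⟩
    rw [← h2]
    exact LinearPMap.domRestrict_apply rfl

/-- Compact support is required of some representative only; the continuous one inherits it, since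
it vanishes almost everywhere, hence everywhere, on the open complement of the support. -/
theorem hasCompactSupport_of_ae_eq {y z : ℝ → ℂ} (hy : Continuous y) (hz : HasCompactSupport z)
    (h : y =ᵐ[volume] z) : HasCompactSupport y := by
  refine HasCompactSupport.intro hz.isCompact fun x hx => ?_
  have hopen : IsOpen (tsupport z)ᶜ := (isClosed_tsupport z).isOpen_compl
  refine Measure.eqOn_open_of_ae_eq (μ := volume) (f := y) (g := fun _ => 0) ?_ hopen
    hy.continuousOn continuousOn_const hx
  rw [EventuallyEq, ae_restrict_iff' hopen.measurableSet]
  filter_upwards [h] with t ht ht'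
  rw [ht, image_eq_zero_of_notMem_tsupport ht']

theorem bv_of_hasCompactSupport_right (w : ℝ → ℂ) {y : ℝ → ℂ} (hy : HasCompactSupport y) :
    bvBot w y = 0 ∧ bvTop w y = 0 := by
  have h : wr w y =ᶠ[cocompact ℝ] fun _ => 0 := by
    filter_upwards [hy.isCompact.compl_mem_cocompact] with x hx
    have h2 : x ∉ tsupport (deriv y) := fun h => hx (tsupport_deriv_subset h)
    rw [wr, image_eq_zero_of_notMem_tsupport hx, image_eq_zero_of_notMem_tsupport h2]
    simp
  constructor
  · exact (tendsto_const_nhds.congr' (h.symm.filter_mono atBot_le_cocompact)).limUnder_eq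
  · exact (tendsto_const_nhds.congr' (h.symm.filter_mono atTop_le_cocompact)).limUnder_eq

theorem inner_green {q : ℝ → ℝ} {p r : L2 × L2} {y z : ℝ → ℂ} (hy : IsMaxFun q y)
    (hz : IsMaxFun q z) (hp1 : p.1 =ᵐ[volume] y) (hp2 : p.2 =ᵐ[volume] tau q y)
    (hr1 : r.1 =ᵐ[volume] z) (hr2 : r.2 =ᵐ[volume] tau q z) :
    ⟪p.2, r.1⟫_ℂ - ⟪p.1, r.2⟫_ℂ = bvTop y z - bvBot y z := by
  rw [inner_eq_integral hp2 hr1, inner_eq_integral hp1 hr2, integral_green hy hz]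

theorem IsMaxFun.eq_of_ae {q : ℝ → ℝ} {f : L2} {y z : ℝ → ℂ} (hy : IsMaxFun q y)
    (hz : IsMaxFun q z) (h1 : f =ᵐ[volume] y) (h2 : f =ᵐ[volume] z) : y = z :=
  (Continuous.ae_eq_iff_eq volume hy.regular.differentiable.continuous
    hz.regular.differentiable.continuous).1 (h1.symm.trans h2)

theorem IsMaxFun.toLp_mem {q : ℝ → ℝ} {y : ℝ → ℂ} (hy : IsMaxFun q y) :
    (hy.memLp.toLp y, hy.memLp_tau.toLp (tau q y)) ∈ maxGraph q :=
  ⟨y, hy, hy.memLp.coeFn_toLp, hy.memLp_tau.coeFn_toLp⟩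

/-- A square integrable function orthogonal to all square integrable functions of compact support
vanishes almost everywhere. -/
theorem ae_eq_zero_of_orthogonal {k : ℝ → ℂ} (hk : MemLp k 2 volume)
    (h : ∀ v : ℝ → ℂ, MemLp v 2 volume → HasCompactSupport v → ∫ t, conj (k t) * v t = 0) :
    k =ᵐ[volume] 0 := by
  have key : ∀ n : ℕ, ∀ᵐ t : ℝ, t ∈ Set.Icc (-(n : ℝ)) n → k t = 0 := by
    intro n
    have hs := measurableSet_Icc (a := -(n : ℝ)) (b := n)
    have h1 := h _ (hk.indicator hs)
      (HasCompactSupport.intro isCompact_Icc fun x hx => Set.indicator_of_notMem hx k)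
    have h2 : (fun t => conj (k t) * (Set.Icc (-(n : ℝ)) n).indicator k t) =
        (Set.Icc (-(n : ℝ)) n).indicator fun t => ((‖k t‖ ^ 2 : ℝ) : ℂ) := by
      funext t
      by_cases ht : t ∈ Set.Icc (-(n : ℝ)) n
      · simp only [Set.indicator_of_mem ht]
        rw [mul_comm, Complex.mul_conj, Complex.normSq_eq_norm_sq]
      · simp [Set.indicator_of_notMem ht]
    rw [h2, integral_indicator hs, integral_complex_ofReal, Complex.ofReal_eq_zero,
      setIntegral_eq_zero_iff_of_nonneg_ae (ae_of_all _ fun _ => by positivity)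
      hk.norm.integrable_sq.integrableOn, EventuallyEq, ae_restrict_iff' hs] at h1
    filter_upwards [h1] with t ht ht'
    simpa using ht ht'
  filter_upwards [ae_all_iff.2 key] with t ht
  obtain ⟨n, hn⟩ := exists_nat_ge |t|
  exact ht n (abs_le.1 hn)

/-- The vector of the boundary values of `f`. -/
def bv (w₁ w₂ f : ℝ → ℂ) : Fin 4 → ℂ := ![bvBot w₁ f, bvBot w₂ f, bvTop w₁ f, bvTop w₂ f]

theorem mem_maxDomainWhere_iff {q : ℝ → ℝ} {C : (ℝ → ℂ) → Prop} {f : L2} {y : ℝ → ℂ}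
    (hy : IsMaxFun q y) (hf : f =ᵐ[volume] y) : f ∈ maxDomainWhere q C ↔ C y :=
  ⟨fun ⟨_, hz, hfz, hC⟩ => hy.eq_of_ae hz hf hfz ▸ hC, fun hC => ⟨y, hy, hf, hC⟩⟩

theorem maxDomainWhere_congr {q : ℝ → ℝ} {C C' : (ℝ → ℂ) → Prop} 
    (h : ∀ y, IsMaxFun q y → (C y ↔ C' y)) : maxDomainWhere q C = maxDomainWhere q C' := by
  ext f
  exact exists_congr fun y => and_congr_right fun hy => and_congr_right fun _ => h y hy

/-! ### The minimal and the maximal operator -/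

namespace IsBasisPair

variable {q : ℝ → ℝ} {w₁ w₂ : ℝ → ℂ} (hw : IsBasisPair q w₁ w₂)
include hw

theorem bv_add {f g : ℝ → ℂ} (hf : IsMaxFun q f) (hg : IsMaxFun q g) :
    bv w₁ w₂ (f + g) = bv w₁ w₂ f + bv w₁ w₂ g := by
  simp [bv, bvBot_add hw.max₁ hf hg, bvBot_add hw.max₂ hf hg, bvTop_add hw.max₁ hf hg,
    bvTop_add hw.max₂ hf hg]

theorem bv_smul (c : ℂ) {f : ℝ → ℂ} (hf : IsMaxFun q f) :
    bv w₁ w₂ (c • f) = c • bv w₁ w₂ f := by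
  simp [bv, bvBot_smul hw.max₁ c hf, bvBot_smul hw.max₂ c hf, bvTop_smul hw.max₁ c hf,
    bvTop_smul hw.max₂ c hf]

theorem exists_bv_eq (v : Fin 4 → ℂ) : ∃ f, IsMaxFun q f ∧ bv w₁ w₂ f = v := by
  obtain ⟨f, hf, h1, h2, h3, h4⟩ := hw.exists_bv (v 0) (v 1) (v 2) (v 3)
  refine ⟨f, hf, ?_⟩
  rw [bv, h1, h2, h3, h4]
  ext i; fin_cases i <;> rfl

/-- This moves all adjoint computations from `L²` to a nondegenerate form on `ℂ⁴`. -/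
theorem form_eq {f g : ℝ → ℂ} (hf : IsMaxFun q f) (hg : IsMaxFun q g) :
    bvTop f g - bvBot f g = conj (bv w₁ w₂ f 2) * bv w₁ w₂ g 3 - conj (bv w₁ w₂ f 3) * bv w₁ w₂ g 2
      - (conj (bv w₁ w₂ f 0) * bv w₁ w₂ g 1 - conj (bv w₁ w₂ f 1) * bv w₁ w₂ g 0) := by
  rw [hw.bvTop_eq hf hg, hw.bvBot_eq hf hg]
  rfl

/-- The vanishing moments make `varConst w₁ w₂ g` a compactly supported preimage of `g` under `τ`,
so it may be tested against `u`. Green's formula without boundary terms does the same for `varConst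
w₁ w₂ v`, and the two results agree. -/
theorem integral_eq_of_orthogonal {u v : L2}
    (h : ∀ p ∈ (preMinOp q).graph, ⟪u, p.2⟫_ℂ = ⟪v, p.1⟫_ℂ) {g : ℝ → ℂ} (hg : MemLp g 2 volume)
    (hs : HasCompactSupport g) (h₁ : ∫ t, w₁ t * g t = 0) (h₂ : ∫ t, w₂ t * g t = 0) :
    ∫ t, conj (u t - varConst w₁ w₂ v t) * g t = 0 := by
  have hv : MemLp v 2 volume := Lp.memLp v
  have mz := hw.isMaxFun_varConst hv
  have my := hw.isMaxFun_varConst hg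
  have hc := hasCompactSupport_varConst hs h₁ h₂
  have h3 := h _ (mem_preMinOp_graph.2 ⟨my.toLp_mem, _, hc, my.memLp.coeFn_toLp⟩)
  rw [inner_eq_integral (ae_eq_refl u) (my.memLp_tau.coeFn_toLp.trans (hw.tau_varConst hg)),
    inner_eq_integral (hw.tau_varConst hv).symm my.memLp.coeFn_toLp] at h3
  have h4 := integral_green mz my
  rw [(bv_of_hasCompactSupport_right _ hc).1, (bv_of_hasCompactSupport_right _ hc).2, sub_self,
    sub_eq_zero] at h4
  have h5 : ∫ x, conj (varConst w₁ w₂ v x) * tau q (varConst w₁ w₂ g) x =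
      ∫ x, conj (varConst w₁ w₂ v x) * g x :=
    integral_congr_ae ((hw.tau_varConst hg).mono fun x hx => by simp only [hx])
  have i1 : Integrable fun x => conj (u x) * g x := (Lp.memLp u).star.integrable_mul hg
  have i2 : Integrable fun x => conj (varConst w₁ w₂ v x) * g x :=
    mz.memLp.star.integrable_mul hg
  simp only [map_sub, sub_mul]
  rw [integral_sub i1 i2, h3, h4, h5, sub_self]

/-- The adjoint of the pre-minimal operator is contained in the maximal operator. -/
theorem mem_maxGraph_of_orthogonal {u v : L2}
    (h : ∀ p ∈ (preMinOp q).graph, ⟪u, p.2⟫_ℂ = ⟪v, p.1⟫_ℂ) : (u, v) ∈ maxGraph q := by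
  have hv : MemLp v 2 volume := Lp.memLp v
  have mz := hw.isMaxFun_varConst hv
  set k : ℝ → ℂ := fun t => u t - varConst w₁ w₂ v t with hk_def
  have hk : MemLp k 2 volume := (Lp.memLp u).sub mz.memLp
  -- The functions `g₁, g₂` are dual to `w₁, w₂`: subtracting the moments of `g` times them turns
  -- any compactly supported `g` into one with zero moments.
  obtain ⟨g₁, m₁, s₁, g₁₁, g₁₂⟩ := hw.exists_moments 1 0
  obtain ⟨g₂, m₂, s₂, g₂₁, g₂₂⟩ := hw.exists_moments 0 1
  set c₁ : ℂ := ∫ t, conj (k t) * g₁ t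
  set c₂ : ℂ := ∫ t, conj (k t) * g₂ t
  have m1 := hw.max₁.memLp
  have m2 := hw.max₂.memLp
  -- A functional that vanishes wherever the moments against `w₁` and `w₂` do is a combination of
  -- these moments; so `u` differs from `varConst w₁ w₂ v` by a solution of the homogeneous
  -- equation.
  have hk' : (fun t => k t - (conj c₁ * w₁ t + conj c₂ * w₂ t)) =ᵐ[volume] 0 := by
    refine ae_eq_zero_of_orthogonal (hk.sub ((m1.const_mul _).add (m2.const_mul _))) ?_
    intro g hg hs
    set μ₁ : ℂ := ∫ t, w₁ t * g t
    set μ₂ : ℂ := ∫ t, w₂ t * g t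
    have split : ∀ f : ℝ → ℂ, MemLp f 2 volume →
        ∫ t, f t * (g t - (μ₁ * g₁ t + μ₂ * g₂ t)) =
          (∫ t, f t * g t) - (μ₁ * (∫ t, f t * g₁ t) + μ₂ * ∫ t, f t * g₂ t) := by
      intro f hf
      have e : (fun t => f t * (g t - (μ₁ * g₁ t + μ₂ * g₂ t))) =
          fun t => f t * g t - (μ₁ * (f t * g₁ t) + μ₂ * (f t * g₂ t)) := by funext t; ring
      have i0 : Integrable fun t => f t * g t := hf.integrable_mul hg
      have i1 : Integrable fun t => f t * g₁ t := hf.integrable_mul m₁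
      have i2 : Integrable fun t => f t * g₂ t := hf.integrable_mul m₂
      rw [e, integral_sub_add i0 i1 i2]
    have h0 := hw.integral_eq_of_orthogonal h
      (g := fun t => g t - (μ₁ * g₁ t + μ₂ * g₂ t))
      (hg.sub ((m₁.const_mul _).add (m₂.const_mul _)))
      (hs.sub (s₁.mul_left.add s₂.mul_left))
      (by rw [split _ m1, g₁₁, g₂₁]; simp [μ₁]) (by rw [split _ m2, g₁₂, g₂₂]; simp [μ₂])
    have hkc : MemLp (fun t => conj (k t)) 2 volume := hk.star
    change ∫ t, conj (k t) * (g t - (μ₁ * g₁ t + μ₂ * g₂ t)) = 0 at h0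
    rw [split _ hkc] at h0
    have e : (fun t => conj (k t - (conj c₁ * w₁ t + conj c₂ * w₂ t)) * g t) =
        fun t => conj (k t) * g t - (c₁ * (w₁ t * g t) + c₂ * (w₂ t * g t)) := by
      funext t
      simp only [map_sub, map_add, map_mul, Complex.conj_conj, hw.real₁, hw.real₂]
      ring
    have i0 : Integrable fun t => conj (k t) * g t := hkc.integrable_mul hg
    have i1 := hw.integrable_mul₁ hg
    have i2 := hw.integrable_mul₂ hg
    rw [e, integral_sub_add i0 i1 i2]
    linear_combination h0
  have n1 := hw.max₁.smul (conj c₁)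
  have n2 := hw.max₂.smul (conj c₂)
  refine ⟨varConst w₁ w₂ v + (conj c₁ • w₁ + conj c₂ • w₂), mz.add (n1.add n2), ?_, ?_⟩
  · filter_upwards [hk'] with t ht
    simp only [hk_def, Pi.zero_apply] at ht
    simp only [Pi.add_apply, Pi.smul_apply, smul_eq_mul]
    linear_combination ht
  · filter_upwards [tau_add q mz.regular (n1.add n2).regular, tau_add q n1.regular n2.regular,
      tau_smul q (conj c₁) hw.max₁.regular, tau_smul q (conj c₂) hw.max₂.regular,
      hw.tau_varConst hv, hw.sol₁.eq, hw.sol₂.eq] with t t1 t2 t3 t4 t5 t6 t7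
    simp only [Pi.add_apply, Pi.smul_apply, smul_eq_mul] at t1 t2 t3 t4
    rw [t1, t2, t3, t4, t5, t6, t7]
    simp

theorem adjoint_preMinOp_graph : (preMinOp q).graph.adjoint = maxGraph q := by
  ext ⟨u, v⟩
  rw [Submodule.mem_adjoint_iff]
  constructor
  · intro h
    refine hw.mem_maxGraph_of_orthogonal fun p hp => ?_
    have := h p.1 p.2 hp
    rw [sub_eq_zero] at this
    rw [← inner_conj_symm, this, inner_conj_symm]
  · rintro ⟨z, hz, hz1, hz2⟩ a b hab
    obtain ⟨⟨y, hy, hy1, hy2⟩, ⟨y', hc, hy'⟩⟩ := mem_preMinOp_graph.1 hab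
    have hc' : HasCompactSupport y := hasCompactSupport_of_ae_eq
      hy.regular.differentiable.continuous hc (hy1.symm.trans hy')
    have h0 := hw.form_eq hy hz
    have hb1 := bv_of_hasCompactSupport_right w₁ hc'
    have hb2 := bv_of_hasCompactSupport_right w₂ hc'
    rw [inner_green (p := (a, b)) (r := (u, v)) hy hz hy1 hy2 hz1 hz2, h0]
    simp [bv, hb1.1, hb1.2, hb2.1, hb2.2]

/-- If `k` is orthogonal to the domain, then `(0, k)` lies in the adjoint relation, hence in the
graph of `A_max`, and `k = A_max 0 = 0`. -/
theorem dense_preMinOp : Dense ((preMinOp q).domain : Set L2) := by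
  rw [Submodule.dense_iff_topologicalClosure_eq_top, Submodule.topologicalClosure_eq_top_iff,
    Submodule.eq_bot_iff]
  intro k hk
  rw [Submodule.mem_orthogonal'] at hk
  have h : ((0 : L2), k) ∈ maxGraph q := hw.mem_maxGraph_of_orthogonal fun p hp => by
    rw [inner_zero_left, hk _ (LinearPMap.mem_domain_of_mem_graph hp)]
  rw [← maxOp_graph] at h
  exact (maxOp q).graph_fst_eq_zero_snd h rfl

theorem isClosed_maxOp : (maxOp q).IsClosed := by
  have h : (preMinOp q)† = maxOp q := LinearPMap.eq_of_eq_graph (by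
    rw [LinearPMap.adjoint_graph_eq_graph_adjoint hw.dense_preMinOp, hw.adjoint_preMinOp_graph,
      maxOp_graph])
  rw [← h]
  exact LinearPMap.adjoint_isClosed hw.dense_preMinOp

theorem minOp_graph : (minOp q).graph = (preMinOp q).graph.topologicalClosure :=
  (hw.isClosed_maxOp.isClosable.leIsClosable
    LinearPMap.domRestrict_le).graph_closure_eq_closure_graph.symm

theorem adjoint_minOp_graph : (minOp q).graph.adjoint = maxGraph q := by
  rw [hw.minOp_graph, adjoint_topologicalClosure, hw.adjoint_preMinOp_graph]

theorem dense_minOp : Dense ((minOp q).domain : Set L2) :=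
  hw.dense_preMinOp.mono (preMinOp q).le_closure.1

theorem adjoint_minOp : (minOp q)† = maxOp q :=
  LinearPMap.eq_of_eq_graph (by
    rw [LinearPMap.adjoint_graph_eq_graph_adjoint hw.dense_minOp, hw.adjoint_minOp_graph,
      maxOp_graph])

theorem minOp_graph_le : (minOp q).graph ≤ maxGraph q := by
  rw [hw.minOp_graph, ← maxOp_graph]
  exact Submodule.topologicalClosure_minimal _
    (LinearPMap.le_graph_of_le LinearPMap.domRestrict_le) hw.isClosed_maxOp

/-- The boundary form of an element of `dom A` with every maximal function is zero, and since all
boundary vectors occur, nondegeneracy forces its own vector to vanish. Conversely, a zero vector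
makes the pair orthogonal to the whole adjoint graph, which puts it in the closure. -/
theorem mem_minOp_graph {p : L2 × L2} : p ∈ (minOp q).graph ↔
    ∃ y, IsMaxFun q y ∧ p.1 =ᵐ[volume] y ∧ p.2 =ᵐ[volume] tau q y ∧ bv w₁ w₂ y = 0 := by
  constructor
  · intro hp
    have h1 := hw.minOp_graph_le hp
    obtain ⟨y, hy, h1, h2⟩ := h1
    refine ⟨y, hy, h1, h2, ?_⟩
    have h3 : ∀ v : Fin 4 → ℂ, conj (bv w₁ w₂ y 2) * v 3 - conj (bv w₁ w₂ y 3) * v 2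
        - (conj (bv w₁ w₂ y 0) * v 1 - conj (bv w₁ w₂ y 1) * v 0) = 0 := by
      intro v
      obtain ⟨z, hz, rfl⟩ := hw.exists_bv_eq v
      have h4 := hz.toLp_mem
      rw [← hw.adjoint_minOp_graph, Submodule.mem_adjoint_iff] at h4
      rw [← hw.form_eq hy hz, ← inner_green (p := p)
        (r := (hz.memLp.toLp z, hz.memLp_tau.toLp _)) hy hz h1 h2 hz.memLp.coeFn_toLp
        hz.memLp_tau.coeFn_toLp]
      exact h4 p.1 p.2 hp
    -- Each test vector isolates one conjugated coordinate of the boundary vector of `y`.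
    have e0 := h3 ![0, 1, 0, 0]
    have e1 := h3 ![1, 0, 0, 0]
    have e2 := h3 ![0, 0, 0, 1]
    have e3 := h3 ![0, 0, 1, 0]
    simp at e0 e1 e2 e3
    ext i
    fin_cases i
    exacts [e0, e1, e2, e3]
  · rintro ⟨y, hy, h1, h2, h0⟩
    rw [hw.minOp_graph]
    refine mem_topologicalClosure_of_adjoint ?_
    rw [hw.adjoint_preMinOp_graph]
    rintro x ⟨z, hz, hz1, hz2⟩
    rw [inner_green hy hz h1 h2 hz1 hz2, hw.form_eq hy hz, h0]
    simp

theorem minOp_domain : ((minOp q).domain : Set L2) =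
    maxDomainWhere q fun y => bv w₁ w₂ y = 0 := by
  ext f
  constructor
  · intro hf
    obtain ⟨y, hy, h1, -, h2⟩ := hw.mem_minOp_graph.1 ((minOp q).mem_graph ⟨f, hf⟩)
    exact ⟨y, hy, h1, h2⟩
  · rintro ⟨y, hy, h1, h2⟩
    exact LinearPMap.mem_domain_of_mem_graph (hw.mem_minOp_graph (p := (f, hy.memLp_tau.toLp _)) |>.2
      ⟨y, hy, h1, hy.memLp_tau.coeFn_toLp, h2⟩)

end IsBasisPair

/-! ### The parity operator -/

theorem coeFn_parity {f : L2} {y : ℝ → ℂ} (h : f =ᵐ[volume] y) :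
    parity f =ᵐ[volume] fun x => y (-x) := by
  have hmp := Measure.measurePreserving_neg (volume : Measure ℝ)
  exact (Lp.coeFn_compMeasurePreserving f hmp).trans
    (hmp.quasiMeasurePreserving.ae_eq_comp h)

theorem parity_parity (f : L2) : parity (parity f) = f := by
  refine Lp.ext ?_
  have h := coeFn_parity (coeFn_parity (ae_eq_refl f))
  simpa only [neg_neg] using h

theorem mem_parityConj_graph {T : L2 →ₗ.[ℂ] L2} {p : L2 × L2} :
    p ∈ (parityConj T).graph ↔ (parity p.1, parity p.2) ∈ T.graph := by
  rw [LinearPMap.mem_graph_iff, LinearPMap.mem_graph_iff]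
  constructor
  · rintro ⟨⟨x, hx⟩, h1, h2⟩
    refine ⟨⟨parity x, hx⟩, congrArg parity h1, ?_⟩
    rw [← h2]
    exact (parity_parity _).symm
  · rintro ⟨⟨x, hx⟩, h1, h2⟩
    have hx' : p.1 ∈ (parityConj T).domain := by
      change (parity p.1, parity p.2).1 ∈ T.domain
      rw [← h1]; exact hx
    refine ⟨⟨p.1, hx'⟩, rfl, ?_⟩
    have h3 : (parityConj T) ⟨p.1, hx'⟩ = parity (T ⟨parity p.1, hx'⟩) := rfl
    have h4 : (⟨parity p.1, hx'⟩ : T.domain) = ⟨x, hx⟩ := Subtype.ext h1.symm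
    rw [h3, h4, h2]
    exact parity_parity _

theorem isClosed_parityConj {T : L2 →ₗ.[ℂ] L2} (hT : T.IsClosed) : (parityConj T).IsClosed := by
  have h : ((parityConj T).graph : Set (L2 × L2)) =
      (fun p : L2 × L2 => (parity p.1, parity p.2)) ⁻¹' T.graph := by
    ext p
    exact mem_parityConj_graph
  rw [LinearPMap.IsClosed, h]
  exact hT.preimage ((parity.continuous.comp continuous_fst).prodMk
    (parity.continuous.comp continuous_snd))

theorem parity_mem_maxGraph {q : ℝ → ℝ} (hq : ∀ x, q (-x) = q x) {p : L2 × L2}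
    (hp : p ∈ maxGraph q) : (parity p.1, parity p.2) ∈ maxGraph q := by
  obtain ⟨y, hy, h1, h2⟩ := hp
  obtain ⟨hy', ht⟩ := hy.comp_neg hq
  refine ⟨_, hy', coeFn_parity h1, ?_⟩
  rw [ht]
  exact coeFn_parity h2

theorem parityConj_graph_le {q : ℝ → ℝ} (hq : ∀ x, q (-x) = q x) {T : L2 →ₗ.[ℂ] L2}
    (hT : T.graph ≤ maxGraph q) : (parityConj T).graph ≤ maxGraph q := by
  intro p hp
  have h := parity_mem_maxGraph hq (hT (mem_parityConj_graph.1 hp))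
  simpa only [parity_parity] using h

theorem parityConj_domain {q : ℝ → ℝ} (hq : ∀ x, q (-x) = q x) {T : L2 →ₗ.[ℂ] L2}
    {C : (ℝ → ℂ) → Prop} (hT : (T.domain : Set L2) = maxDomainWhere q C) :
    ((parityConj T).domain : Set L2) = maxDomainWhere q fun y => C fun x => y (-x) := by
  have h : ∀ f : L2, f ∈ (parityConj T).domain ↔ parity f ∈ (T.domain : Set L2) := fun _ => Iff.rfl
  ext f
  rw [SetLike.mem_coe, h, hT]
  constructor
  · rintro ⟨y, hy, h1, h2⟩
    refine ⟨_, (hy.comp_neg hq).1, ?_, by simpa only [neg_neg] using h2⟩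
    simpa only [parity_parity] using coeFn_parity h1
  · rintro ⟨y, hy, h1, h2⟩
    exact ⟨_, (hy.comp_neg hq).1, coeFn_parity h1, h2⟩

/-! ### Extensions of the minimal operator -/

/-- A restriction of `A_max` is determined by its domain, because `A_max` is single valued. -/
theorem mem_graph_of_mem_domain {q : ℝ → ℝ} {S : L2 →ₗ.[ℂ] L2} (hS : S.graph ≤ maxGraph q)
    {p : L2 × L2} (hp : p ∈ maxGraph q) (h : p.1 ∈ S.domain) : p ∈ S.graph := by
  have h1 := S.mem_graph ⟨p.1, h⟩
  have h2 := hS h1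
  rw [← maxOp_graph] at hp h2
  have h3 : S ⟨p.1, h⟩ = p.2 := (maxOp q).mem_graph_snd_inj h2 hp rfl
  rw [h3] at h1
  exact h1

/-- The six equations are, up to sign, the vanishing two-by-two minors of `z` against the nonzero
vector `(-B, A, -D, C)`, so the two are proportional. -/
theorem exists_smul_of_minors {A B C D z₀ z₁ z₂ z₃ : ℂ} (h0 : A ≠ 0 ∨ B ≠ 0 ∨ C ≠ 0 ∨ D ≠ 0)
    (e01 : A * z₀ + B * z₁ = 0) (e02 : A * z₃ - C * z₁ = 0) (e03 : A * z₂ + D * z₁ = 0)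
    (e12 : B * z₃ + C * z₀ = 0) (e13 : D * z₀ - B * z₂ = 0) (e23 : D * z₃ + C * z₂ = 0) :
    ∃ t : ℂ, z₀ = t * -B ∧ z₁ = t * A ∧ z₂ = t * -D ∧ z₃ = t * C := by
  rcases h0 with h | h | h | h
  · refine ⟨z₁ / A, ?_, ?_, ?_, ?_⟩ <;> field_simp <;> grind
  · refine ⟨-(z₀ / B), ?_, ?_, ?_, ?_⟩ <;> field_simp <;> grind
  · refine ⟨z₃ / C, ?_, ?_, ?_, ?_⟩ <;> field_simp <;> grind
  · refine ⟨-(z₂ / D), ?_, ?_, ?_, ?_⟩ <;> field_simp <;> grind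

/-- The complement of a hyperplane under a nondegenerate form is a line. It is enough to test with
the six vectors of the hyperplane supported on two coordinates; each yields one minor. -/
theorem orthogonal_of_hyperplane {a b c d : ℂ} (h0 : ‖a‖ + ‖b‖ + ‖c‖ + ‖d‖ ≠ 0) (z : Fin 4 → ℂ)
    (h : ∀ v : Fin 4 → ℂ, a * v 0 + b * v 1 = c * v 2 + d * v 3 →
      conj (v 2) * z 3 - conj (v 3) * z 2 - (conj (v 0) * z 1 - conj (v 1) * z 0) = 0) :
    ∃ t : ℂ, z = t • ![-conj b, conj a, -conj d, conj c] := by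
  have e01 := h ![-b, a, 0, 0] (by simp; ring)
  have e02 := h ![c, 0, a, 0] (by simp; ring)
  have e03 := h ![d, 0, 0, a] (by simp; ring)
  have e12 := h ![0, c, b, 0] (by simp; ring)
  have e13 := h ![0, d, 0, b] (by simp; ring)
  have e23 := h ![0, 0, -d, c] (by simp; ring)
  simp only [Matrix.cons_val, map_neg, map_zero] at e01 e02 e03 e12 e13 e23
  have h1 : conj a ≠ 0 ∨ conj b ≠ 0 ∨ conj c ≠ 0 ∨ conj d ≠ 0 := by
    simp only [ne_eq, map_eq_zero]
    by_contra! h'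
    simp [h'] at h0
  obtain ⟨t, h0, h1, h2, h3⟩ := exists_smul_of_minors h1 (z₀ := z 0) (z₁ := z 1) (z₂ := z 2)
    (z₃ := z 3) (by linear_combination e01) (by linear_combination e02)
    (by linear_combination -e03) (by linear_combination e12) (by linear_combination e13)
    (by linear_combination -e23)
  exact ⟨t, by ext i; fin_cases i; exacts [h0, h1, h2, h3]⟩

theorem bv_eq_smul_iff {w₁ w₂ y : ℝ → ℂ} {x₁ x₂ y₁ y₂ : ℂ} :
    (∃ t : ℂ, bv w₁ w₂ y = t • ![x₁, x₂, y₁, y₂]) ↔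
      ∃ t : ℂ, bvBot w₁ y = t * x₁ ∧ bvBot w₂ y = t * x₂ ∧ bvTop w₁ y = t * y₁ ∧
        bvTop w₂ y = t * y₂ := by
  refine exists_congr fun t => ?_
  simp [bv, funext_iff, Fin.forall_fin_succ]

namespace IsBasisPair

variable {q : ℝ → ℝ} {w₁ w₂ : ℝ → ℂ} (hw : IsBasisPair q w₁ w₂)
include hw

theorem exists_bv_comp_neg_iff {y : ℝ → ℂ} (hy : IsMaxFun q y) {x₁ x₂ y₁ y₂ : ℂ} :
    (∃ t : ℂ, bv w₁ w₂ (fun x => y (-x)) = t • ![x₁, x₂, y₁, y₂]) ↔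
      ∃ t : ℂ, bv w₁ w₂ y = t • ![y₁, -y₂, x₁, -x₂] := by
  rw [bv_eq_smul_iff, bv_eq_smul_iff]
  obtain ⟨h1, h2, h3, h4⟩ := hw.bv_comp_neg hy
  refine exists_congr fun t => ?_
  rw [h1, h2, h3, h4, neg_eq_iff_eq_neg, neg_eq_iff_eq_neg, mul_neg, mul_neg]
  tauto

/-- A closed restriction of the maximal operator whose boundary values fill a line is a
one-dimensional extension of the minimal operator. -/
theorem isBiExtension_one {S : L2 →ₗ.[ℂ] L2} (hc : S.IsClosed) (hS : S.graph ≤ maxGraph q)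
    {v : Fin 4 → ℂ} (hv : v ≠ 0)
    (hdom : (S.domain : Set L2) = maxDomainWhere q fun y => ∃ t : ℂ, bv w₁ w₂ y = t • v) :
    IsBiExtension (minOp q) S 1 := by
  have hmem : ∀ f, f ∈ S.domain ↔ f ∈ maxDomainWhere q fun y => ∃ t : ℂ, bv w₁ w₂ y = t • v :=
    fun f => by rw [← hdom]; rfl
  have hmin : ∀ f, f ∈ (minOp q).domain ↔ f ∈ maxDomainWhere q fun y => bv w₁ w₂ y = 0 :=
    fun f => by rw [← hw.minOp_domain]; rfl
  refine ⟨hc, LinearPMap.le_of_le_graph fun p hp => ?_, ?_, ?_⟩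
  · obtain ⟨y, hy, h1, -, h3⟩ := hw.mem_minOp_graph.1 hp
    exact mem_graph_of_mem_domain hS (hw.minOp_graph_le hp)
      ((hmem _).2 ⟨y, hy, h1, 0, by rw [h3, zero_smul]⟩)
  · rw [hw.adjoint_minOp]
    exact LinearPMap.le_of_le_graph (by rwa [maxOp_graph])
  · obtain ⟨f₀, hf₀, hb₀⟩ := hw.exists_bv_eq v
    have hd₀ : hf₀.memLp.toLp f₀ ∈ S.domain :=
      (hmem _).2 ⟨f₀, hf₀, hf₀.memLp.coeFn_toLp, 1, by rw [hb₀, one_smul]⟩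
    rw [Nat.cast_one, rank_eq_one_iff]
    -- The class of a function with boundary vector `v` generates the quotient: it is nonzero as `v
    -- ≠ 0`, and if `f` has boundary vector `t • v`, then `f - t • f₀` has boundary vector zero and
    -- lies in `dom A`.
    refine ⟨Submodule.Quotient.mk ⟨_, hd₀⟩, fun h => ?_, fun f => ?_⟩
    · rw [Submodule.Quotient.mk_eq_zero, Submodule.submoduleOf, Submodule.mem_comap, hmin] at h
      exact hv (hb₀.symm.trans ((mem_maxDomainWhere_iff hf₀ hf₀.memLp.coeFn_toLp).1 h))
    · obtain ⟨⟨f, hf⟩, rfl⟩ := Submodule.Quotient.mk_surjective _ f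
      obtain ⟨y, hy, h1, t, ht⟩ := (hmem f).1 hf
      refine ⟨t, ?_⟩
      rw [← Submodule.Quotient.mk_smul, eq_comm, Submodule.Quotient.eq,
        Submodule.submoduleOf, Submodule.mem_comap, hmin]
      refine ⟨y + (-t) • f₀, hy.add (hf₀.smul _), ?_, ?_⟩
      · simp only [Submodule.subtype_apply, Submodule.coe_sub, Submodule.coe_smul]
        filter_upwards [Lp.coeFn_sub f (t • hf₀.memLp.toLp f₀),
          Lp.coeFn_smul t (hf₀.memLp.toLp f₀), h1, hf₀.memLp.coeFn_toLp] with x e1 e2 e3 e4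
        rw [e1, Pi.sub_apply, e2, Pi.smul_apply, e3, e4]
        simp only [Pi.add_apply, Pi.smul_apply, smul_eq_mul]
        ring
      · beta_reduce
        rw [hw.bv_add hy (hf₀.smul _), hw.bv_smul _ hf₀, ht, hb₀, neg_smul, add_neg_cancel]

/-! ### Adjoints of extensions. -/

variable {T : L2 →ₗ.[ℂ] L2} {r : ℕ} (hT : IsBiExtension (minOp q) T r)
include hT

theorem dense_of_isBiExtension : Dense (T.domain : Set L2) :=
  hw.dense_minOp.mono hT.le.1

theorem graph_le_of_isBiExtension : T.graph ≤ maxGraph q := by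
  have h := LinearPMap.le_graph_of_le hT.le_adjoint
  rwa [hw.adjoint_minOp, maxOp_graph] at h

theorem adjoint_graph_le_of_isBiExtension : T†.graph ≤ maxGraph q := by
  rw [LinearPMap.adjoint_graph_eq_graph_adjoint (hw.dense_of_isBiExtension hT),
    ← hw.adjoint_minOp_graph]
  intro x hx
  rw [Submodule.mem_adjoint_iff] at hx ⊢
  exact fun a b hab => hx a b (LinearPMap.le_graph_of_le hT.le hab)

/-- Since `T*` restricts `A_max`, Green's formula describes its domain by orthogonality of boundary
vectors to those of `dom T`. These fill the hyperplane with coefficients `a, b, -c, -d`, whose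
complement under the form is the stated line. -/
theorem adjoint_domain {a b c d : ℂ} (habcd : ‖a‖ + ‖b‖ + ‖c‖ + ‖d‖ ≠ 0)
    (hdom : (T.domain : Set L2) = maxDomainWhere q fun f =>
      a * bvBot w₁ f + b * bvBot w₂ f = c * bvTop w₁ f + d * bvTop w₂ f) :
    (T†.domain : Set L2) = maxDomainWhere q fun g =>
      ∃ t : ℂ, bv w₁ w₂ g = t • ![-conj b, conj a, -conj d, conj c] := by
  have hle := hw.graph_le_of_isBiExtension hT
  have hadj := LinearPMap.adjoint_graph_eq_graph_adjoint (hw.dense_of_isBiExtension hT)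
  ext g
  constructor
  · intro hg
    have h1 := T†.mem_graph ⟨g, hg⟩
    obtain ⟨z, hz, hz1, hz2⟩ := hw.adjoint_graph_le_of_isBiExtension hT h1
    refine ⟨z, hz, hz1, orthogonal_of_hyperplane habcd _ fun v hv => ?_⟩
    obtain ⟨y, hy, rfl⟩ := hw.exists_bv_eq v
    have hyT := mem_graph_of_mem_domain hle hy.toLp_mem (by
      rw [← SetLike.mem_coe, hdom]
      exact ⟨y, hy, hy.memLp.coeFn_toLp, hv⟩)
    rw [hadj, Submodule.mem_adjoint_iff] at h1
    rw [← hw.form_eq hy hz, ← inner_green (p := (hy.memLp.toLp y, hy.memLp_tau.toLp _)) hy hz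
      hy.memLp.coeFn_toLp hy.memLp_tau.coeFn_toLp hz1 hz2]
    exact h1 _ _ hyT
  · rintro ⟨z, hz, hz1, t, ht⟩
    refine LinearPMap.mem_domain_of_mem_graph (y := hz.memLp_tau.toLp _) ?_
    rw [hadj, Submodule.mem_adjoint_iff]
    intro f f' hf
    obtain ⟨y, hy, hy1, hy2⟩ := hle hf
    have hC : f ∈ (T.domain : Set L2) := LinearPMap.mem_domain_of_mem_graph hf
    rw [hdom, mem_maxDomainWhere_iff hy hy1] at hC
    rw [inner_green (p := (f, f')) (r := (g, hz.memLp_tau.toLp _)) hy hz hy1 hy2 hz1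
      hz.memLp_tau.coeFn_toLp, hw.form_eq hy hz, ht]
    have hC' := congrArg conj hC
    simp only [map_add, map_mul] at hC'
    simp [bv]
    linear_combination (-t) * hC'

end IsBasisPair

end

end PTExt

/-! ### The boundary conditions of both adjoints. -/

theorem mainTheorem9
    (q : ℝ → ℝ) (hq : Admissible q)
    (w₁ w₂ : ℝ → ℂ) (hw : IsBasisPair q w₁ w₂)
    (T : L2 →ₗ.[ℂ] L2) (hT : IsBiExtension (minOp q) T 3)
    (a b c d : ℂ) (habcd : ‖a‖ + ‖b‖ + ‖c‖ + ‖d‖ ≠ 0)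
    (hdom : (T.domain : Set L2) = maxDomainWhere q fun f =>
      a * bvBot w₁ f + b * bvBot w₂ f = c * bvTop w₁ f + d * bvTop w₂ f) :
    IsBiExtension (minOp q) T† 1 ∧
    IsBiExtension (minOp q) (kreinAdjoint T) 1 ∧
    (a ≠ 0 →
      (T†.domain : Set L2) = maxDomainWhere q (fun g =>
        conj a * bvBot w₁ g + conj b * bvBot w₂ g = 0 ∧
        !![0, -(conj d / conj a); 0, conj c / conj a].mulVec ![bvBot w₁ g, bvBot w₂ g]
          = ![bvTop w₁ g, bvTop w₂ g]) ∧
      ((kreinAdjoint T).domain : Set L2) = maxDomainWhere q (fun h =>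
        conj a * bvTop w₁ h - conj b * bvTop w₂ h = 0 ∧
        !![0, conj d / conj a; 0, conj c / conj a].mulVec ![bvTop w₁ h, bvTop w₂ h]
          = ![bvBot w₁ h, bvBot w₂ h])) ∧
    (b ≠ 0 →
      (T†.domain : Set L2) = maxDomainWhere q (fun g =>
        conj a * bvBot w₁ g + conj b * bvBot w₂ g = 0 ∧
        !![conj d / conj b, 0; -(conj c / conj b), 0].mulVec ![bvBot w₁ g, bvBot w₂ g]
          = ![bvTop w₁ g, bvTop w₂ g]) ∧
      ((kreinAdjoint T).domain : Set L2) = maxDomainWhere q (fun h =>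
        conj a * bvTop w₁ h - conj b * bvTop w₂ h = 0 ∧
        !![conj d / conj b, 0; conj c / conj b, 0].mulVec ![bvTop w₁ h, bvTop w₂ h]
          = ![bvBot w₁ h, bvBot w₂ h])) ∧
    (c ≠ 0 →
      (T†.domain : Set L2) = maxDomainWhere q (fun g =>
        conj c * bvTop w₁ g + conj d * bvTop w₂ g = 0 ∧
        !![0, -(conj b / conj c); 0, conj a / conj c].mulVec ![bvTop w₁ g, bvTop w₂ g]
          = ![bvBot w₁ g, bvBot w₂ g]) ∧
      ((kreinAdjoint T).domain : Set L2) = maxDomainWhere q (fun h =>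
        conj c * bvBot w₁ h - conj d * bvBot w₂ h = 0 ∧
        !![0, conj b / conj c; 0, conj a / conj c].mulVec ![bvBot w₁ h, bvBot w₂ h]
          = ![bvTop w₁ h, bvTop w₂ h])) ∧
    (d ≠ 0 →
      (T†.domain : Set L2) = maxDomainWhere q (fun g =>
        conj c * bvTop w₁ g + conj d * bvTop w₂ g = 0 ∧
        !![conj b / conj d, 0; -(conj a / conj d), 0].mulVec ![bvTop w₁ g, bvTop w₂ g]
          = ![bvBot w₁ g, bvBot w₂ g]) ∧
      ((kreinAdjoint T).domain : Set L2) = maxDomainWhere q (fun h =>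
        conj c * bvBot w₁ h - conj d * bvBot w₂ h = 0 ∧
        !![conj b / conj d, 0; conj a / conj d, 0].mulVec ![bvBot w₁ h, bvBot w₂ h]
          = ![bvTop w₁ h, bvTop w₂ h])) := by
  have hS := hw.adjoint_domain hT habcd hdom
  have hle := hw.adjoint_graph_le_of_isBiExtension hT
  have hcl := LinearPMap.adjoint_isClosed (hw.dense_of_isBiExtension hT)
  have hK := parityConj_domain hq.even hS
  -- Reflection carries the line of `T*` to the line spanned by `(-d̄, -c̄, -b̄, -ā)`.
  rw [maxDomainWhere_congr fun y hy => hw.exists_bv_comp_neg_iff hy] at hK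
  have hne : conj a ≠ 0 ∨ conj b ≠ 0 ∨ conj c ≠ 0 ∨ conj d ≠ 0 := by
    simp only [ne_eq, map_eq_zero]
    by_contra! h'
    simp [h'] at habcd
  refine ⟨hw.isBiExtension_one hcl hle ?_ hS, hw.isBiExtension_one (isClosed_parityConj hcl)
    (parityConj_graph_le hq.even hle) ?_ hK, fun h => ⟨hS.trans ?_, hK.trans ?_⟩,
    fun h => ⟨hS.trans ?_, hK.trans ?_⟩, fun h => ⟨hS.trans ?_, hK.trans ?_⟩,
    fun h => ⟨hS.trans ?_, hK.trans ?_⟩⟩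
  · intro h0
    simp [funext_iff, Fin.forall_fin_succ] at h0
    simp [h0] at hne
  · intro h0
    simp [funext_iff, Fin.forall_fin_succ] at h0
    simp [h0] at hne
  all_goals
    refine maxDomainWhere_congr fun y _ => bv_eq_smul_iff.trans ?_
    replace h := (map_ne_zero (starRingEnd ℂ)).2 h
    simp only [Matrix.mulVec_fin_two, funext_iff, Fin.forall_fin_two, Matrix.of_apply,
      Matrix.cons_val, zero_mul, zero_add, add_zero]
    generalize bvBot w₁ y = x₁, bvBot w₂ y = x₂, bvTop w₁ y = y₁, bvTop w₂ y = y₂, conj a = A,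
      conj b = B, conj c = C, conj d = D at *
    constructor
    · rintro ⟨t, rfl, rfl, rfl, rfl⟩
      exact ⟨by ring, by field_simp, by field_simp⟩
    · rintro ⟨h1, h2, h3⟩
      field_simp at h2 h3
      -- The parameter `t` is read off from the coordinate of the spanning vector that is nonzero in
      -- the current case. The alternatives alternate between the vector `(-B, A, -D, C)` for `T*`
      -- and `(-D, -C, -B, -A)` for `T⁺`.
      first
        | exact ⟨x₂ / A, by grind, by grind, by grind, by grind⟩
        | exact ⟨-(y₂ / A), by grind, by grind, by grind, by grind⟩
        | exact ⟨-(x₁ / B), by grind, by grind, by grind, by grind⟩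
        | exact ⟨-(y₁ / B), by grind, by grind, by grind, by grind⟩
        | exact ⟨y₂ / C, by grind, by grind, by grind, by grind⟩
        | exact ⟨-(x₂ / C), by grind, by grind, by grind, by grind⟩
        | exact ⟨-(y₁ / D), by grind, by grind, by grind, by grind⟩
        | exact ⟨-(x₁ / D), by grind, by grind, by grind, by grind⟩
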